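/- Let $(\Omega,\mathcal F,\mu)$ be a $\sigma$-finite measure space and let $\mathcal M$ be the set of (classes of) $\mu$-a.e. positive probability densities; write $E_p[f]=\int f\,p\,d\mu$. For $p\in\mathcal M$ let $L^\Phi(p)$, $\Phi=\cosh-1$, be the Orlicz space of random variables $v$ with $E_p[\Phi(\alpha v)]<\infty$ for some $\alpha>0$, with the Luxemburg norm (the gauge of $\{v: E_p[\Phi(v)]\le 1\}$), let $B_p=T_p\mathcal M$ be its subspace of $p$-centered elements, $K_p(u)=\log E_p[e^u]$ for $u \in B_p$, $\mathcal S_p$ the interior in $B_p$ of $\{u: K_p(u)<\infty\}$, $e_p(u)=e^{u-K_p(u)}p$ and $\mathcal E(p)=e_p(\mathcal S_p)$. The exponential manifold is $\mathcal M$ with the charts $s_p=e_p^{-1}:\mathcal E(p)\to\mathcal S_p$, $s_p(q)=\log\frac qp-E_p[\log\frac qp]$. A curve $t\mapsto p(t)\in\mathcal M$ with $p(0)=p$ has velocity $\delta p(0)=w\in B_p$ if $p(t)\in\mathcal E(p)$ for small $t$ and $\frac{d}{dt}s_p(p(t))|_{t=0}=w$ in $B_p$. The Hilbert bundle $H\mathcal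 M$ has fibers $H_p=L^2_0(p)$ (centered square-integrable random variables), the transports $$U_q^p u=\sqrt{\tfrac qp}\,u-\Bigl(1+E_p\bigl[\sqrt{\tfrac qp}\bigr]\Bigr)^{-1}\Bigl(1+\sqrt{\tfrac qp}\Bigr)E_p\bigl[\sqrt{\tfrac qp}\,u\bigr],\qquad U_q^p:H_q\to H_p,$$ and the charts $(q,v)\mapsto(s_p(q),U_q^pv)$; the tangent bundle $T\mathcal M$ has the charts $(q,v)\mapsto(s_p(q),v-E_p[v])$. Differentiability at $p$ of sections and of real functions is Fréchet differentiability in the chart at $p$. For a section $G$ of $T\mathcal M$ and a section $F$ of $H\mathcal M$ put $$D_GF(p)=\tfrac{d}{dt}U_{p(t)}^{p}F(p(t))\big|_{t=0}\in H_p,\qquad p(t)\text{ a curve with }p(0)=p,\ \delta p(0)=G(p).$$ 1. Every $w\in B_p$ is the velocity of a curve through $p$. If $F$ is differentiable at $p$, then the derivative defining $D_GF(p)$ exists in $H_p$ and is the same for all curves with $p(0)=p$, $\delta p(0)=G(p)$. $D$ is a covariant derivative on $H\mathcal M$: for $F,F_1,F_2$ and $\varphi:\mathcal M\to\mathbb R$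 differentiable at $p$, $D_GF(p)$ is given by a continuous linear map $B_p\to H_p$ applied to $G(p)$; $D_G(F_1+F_2)(p)=D_GF_1(p)+D_GF_2(p)$; $D_G(\varphi F)(p)=(D_G\varphi)(p)F(p)+\varphi(p)D_GF(p)$; and if, for some $n\in\{0,1,\dots,\infty\}$, $G$ is of class $C^n$ and $F$ of class $C^{n+1}$ at $p$, then $D_GF$ is of class $C^n$ at $p$. 2. Let $p(t)$ be a curve with $p(0)=p$, $\delta p(0)=w$, and let $F(t)\in H_{p(t)}$ be such that $t\mapsto U_{p(t)}^pF(t)\in H_p$ is differentiable at $0$. Then $\dot F=\lim_{t\to0}(F(t)-F(0))/t$ exists in $p$-probability, $\dot F+\frac12F(0)w\in L^2(p)$, and $$\tfrac{d}{dt}U_{p(t)}^pF(t)\big|_{t=0}=\dot F+\tfrac12F(0)w-E_p\bigl[\dot F+\tfrac12F(0)w\bigr].$$ In particular, this is the value of $D_GF(p)$ if $F$ is a section differentiable at $p$, $F(t)=F(p(t))$ and $w=G(p)$. 3. $D$ is metric: if $F_1,F_2$ are differentiable at $p$, then $q\mapsto E_q[F_1(q)F_2(q)]$ is differentiable at $p$,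 and its derivative along $G$ satisfies $$D_G\,E_p[F_1(p)F_2(p)]=E_p[D_GF_1(p)\,F_2(p)]+E_p[F_1(p)\,D_GF_2(p)].$$ -/

import Mathlib

open MeasureTheory Filter Topology
open scoped ENNReal

noncomputable section

namespace ExpManifold

variable {Ω : Type*} [MeasurableSpace Ω] {μ : Measure Ω}

/-! ### Positive densities -/

/-- The set `𝓜` of (`μ`-a.e. classes of) probability densities which are `μ`-a.e. positive. -/
structure PosDensity (μ : Measure Ω) where
  /-- the density, as a class of `μ`-integrable functions -/
  dens : Lp ℝ 1 μ
  pos : ∀ᵐ ω ∂μ, 0 < dens ω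
  integral_eq_one : ∫ ω, dens ω ∂μ = 1

/-- The probability measure `p · μ`; the expectation `E_p[f]` is `∫ ω, f ω ∂p.meas`. -/
def PosDensity.meas (p : PosDensity μ) : Measure Ω :=
  μ.withDensity fun ω => ENNReal.ofReal (p.dens ω)

theorem PosDensity.integrable (p : PosDensity μ) : Integrable p.dens μ :=
  L1.integrable_coeFn p.dens

theorem PosDensity.measurable_ofReal (p : PosDensity μ) :
    Measurable fun ω => ENNReal.ofReal (p.dens ω) :=
  ENNReal.measurable_ofReal.comp (Lp.stronglyMeasurable p.dens).measurable

instance (p : PosDensity μ) : IsProbabilityMeasure p.meas := by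
  constructor
  rw [PosDensity.meas, withDensity_apply _ MeasurableSet.univ, Measure.restrict_univ,
    ← ofReal_integral_eq_lintegral_ofReal p.integrable (p.pos.mono fun _ h => h.le),
    p.integral_eq_one, ENNReal.ofReal_one]

theorem PosDensity.meas_absolutelyContinuous (p : PosDensity μ) : p.meas ≪ μ :=
  withDensity_absolutelyContinuous _ _

theorem PosDensity.absolutelyContinuous_meas (p : PosDensity μ) : μ ≪ p.meas :=
  withDensity_absolutelyContinuous' p.measurable_ofReal.aemeasurable
    (p.pos.mono fun _ h => by simpa using h)

theorem PosDensity.integrable_meas_iff (p : PosDensity μ) {g : Ω → ℝ} :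
    Integrable g p.meas ↔ Integrable (fun ω => g ω * p.dens ω) μ := by
  rw [PosDensity.meas, integrable_withDensity_iff p.measurable_ofReal (by simp)]
  refine integrable_congr (p.pos.mono fun ω h => ?_)
  simp [ENNReal.toReal_ofReal h.le]

theorem PosDensity.integral_meas (p : PosDensity μ) (g : Ω → ℝ) :
    ∫ ω, g ω ∂p.meas = ∫ ω, g ω * p.dens ω ∂μ := by
  rw [PosDensity.meas, integral_withDensity_eq_integral_toReal_smul p.measurable_ofReal (by simp)]
  refine integral_congr_ae (p.pos.mono fun ω h => ?_)
  simp [ENNReal.toReal_ofReal h.le, mul_comm]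

/-! ### The exponential Orlicz space and its Luxemburg norm -/

/-- The Young function `Φ = cosh - 1`. -/
def Phi (x : ℝ) : ℝ := Real.cosh x - 1

theorem Phi_nonneg (x : ℝ) : 0 ≤ Phi x := sub_nonneg.2 (Real.one_le_cosh x)

theorem Phi_zero : Phi 0 = 0 := by simp [Phi]

theorem continuous_Phi : Continuous Phi := Real.continuous_cosh.sub continuous_const

theorem Phi_le_Phi {x y : ℝ} (h : |x| ≤ |y|) : Phi x ≤ Phi y :=
  sub_le_sub_right (Real.cosh_le_cosh.2 h) 1

theorem Phi_convex {a b : ℝ} (ha : 0 ≤ a) (hb : 0 ≤ b) (hab : a + b = 1) (x y : ℝ) :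
    Phi (a * x + b * y) ≤ a * Phi x + b * Phi y := by
  have h1 := convexOn_exp.2 (Set.mem_univ x) (Set.mem_univ y) ha hb hab
  have h2 := convexOn_exp.2 (Set.mem_univ (-x)) (Set.mem_univ (-y)) ha hb hab
  simp only [smul_eq_mul] at h1 h2
  have h3 : -(a * x + b * y) = a * -x + b * -y := by ring
  simp only [Phi, Real.cosh_eq]
  rw [h3]
  nlinarith

theorem sq_le_Phi (x : ℝ) : x ^ 2 ≤ 4 * Phi x := by
  have h1 := Real.quadratic_le_exp_of_nonneg (abs_nonneg x)
  have h2 := Real.add_one_le_exp (-|x|)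
  have h3 : Phi x = Phi |x| := by simp [Phi]
  rw [h3, Phi, Real.cosh_eq]
  nlinarith [sq_abs x]

/-- `E_p[Φ(v)]`, with values in `[0, ∞]`. -/
def modular (p : PosDensity μ) (v : Ω → ℝ) : ℝ≥0∞ :=
  ∫⁻ ω, ENNReal.ofReal (Phi (v ω)) ∂p.meas

theorem modular_congr (p : PosDensity μ) {v w : Ω → ℝ} (h : v =ᵐ[p.meas] w) :
    modular p v = modular p w :=
  lintegral_congr_ae (h.mono fun ω hω => by simp only [hω])

theorem modular_mono (p : PosDensity μ) {v w : Ω → ℝ} (h : ∀ᵐ ω ∂p.meas, |v ω| ≤ |w ω|) :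
    modular p v ≤ modular p w :=
  lintegral_mono_ae (h.mono fun _ hω => ENNReal.ofReal_le_ofReal (Phi_le_Phi hω))

theorem modular_convex (p : PosDensity μ) {a b : ℝ} (ha : 0 ≤ a) (hb : 0 ≤ b) (hab : a + b = 1)
    {v w : Ω → ℝ} (hv : AEStronglyMeasurable v p.meas) :
    modular p (fun ω => a * v ω + b * w ω) ≤
      ENNReal.ofReal a * modular p v + ENNReal.ofReal b * modular p w := by
  have hm : AEMeasurable (fun ω => ENNReal.ofReal (Phi (v ω))) p.meas :=
    ENNReal.measurable_ofReal.comp_aemeasurable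
      (continuous_Phi.measurable.comp_aemeasurable hv.aemeasurable)
  calc modular p (fun ω => a * v ω + b * w ω)
      ≤ ∫⁻ ω, (ENNReal.ofReal a * ENNReal.ofReal (Phi (v ω)) +
          ENNReal.ofReal b * ENNReal.ofReal (Phi (w ω))) ∂p.meas := by
        refine lintegral_mono fun ω => ?_
        rw [← ENNReal.ofReal_mul ha, ← ENNReal.ofReal_mul hb,
          ← ENNReal.ofReal_add (mul_nonneg ha (Phi_nonneg _)) (mul_nonneg hb (Phi_nonneg _))]
        exact ENNReal.ofReal_le_ofReal (Phi_convex ha hb hab _ _)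
    _ = _ := by
        rw [lintegral_add_left' (hm.const_mul _), lintegral_const_mul' _ _ ENNReal.ofReal_ne_top,
          lintegral_const_mul' _ _ ENNReal.ofReal_ne_top, modular, modular]

/-- The exponential Orlicz space `L^Φ(p)` as a space of classes of random variables `v`:
`E_p[Φ(α v)] < ∞` for some `α > 0`. -/
def orliczSubmodule (p : PosDensity μ) : Submodule ℝ (Ω →ₘ[p.meas] ℝ) where
  carrier := {v | ∃ α : ℝ, 0 < α ∧ modular p (fun ω => α * v ω) < ∞}
  zero_mem' := by
    refine ⟨1, one_pos, ?_⟩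
    rw [modular_congr p (w := fun _ => 0)
      ((AEEqFun.coeFn_zero (β := ℝ) (μ := p.meas)).mono fun ω h => by
        rw [h, Pi.zero_apply, mul_zero])]
    simp [modular, Phi_zero]
  add_mem' := by
    rintro v w ⟨α, hα, hv⟩ ⟨β, hβ, hw⟩
    refine ⟨min α β / 2, by positivity, ?_⟩
    have hm : 0 < min α β := lt_min hα hβ
    have h1 : modular p (fun ω => min α β * v ω) < ∞ :=
      (modular_mono p (.of_forall fun ω => by
        rw [abs_mul, abs_mul, abs_of_pos hm, abs_of_pos hα]
        gcongr
        exact min_le_left _ _)).trans_lt hv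
    have h2 : modular p (fun ω => min α β * w ω) < ∞ :=
      (modular_mono p (.of_forall fun ω => by
        rw [abs_mul, abs_mul, abs_of_pos hm, abs_of_pos hβ]
        gcongr
        exact min_le_right _ _)).trans_lt hw
    rw [modular_congr p (w := fun ω => (1 / 2 : ℝ) * (min α β * v ω) +
      (1 / 2 : ℝ) * (min α β * w ω))
      ((AEEqFun.coeFn_add v w).mono fun ω h => by
        simp only [h, Pi.add_apply]; ring)]
    refine (modular_convex p (by norm_num) (by norm_num) (by norm_num)
      (v.aestronglyMeasurable.const_mul _)).trans_lt ?_
    exact ENNReal.add_lt_top.2 ⟨ENNReal.mul_lt_top ENNReal.ofReal_lt_top h1,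
      ENNReal.mul_lt_top ENNReal.ofReal_lt_top h2⟩
  smul_mem' := by
    rintro c v ⟨α, hα, hv⟩
    refine ⟨α / (|c| + 1), by positivity, ?_⟩
    refine (modular_mono p ((AEEqFun.coeFn_smul c v).mono fun ω h => ?_)).trans_lt hv
    simp only [h, Pi.smul_apply, smul_eq_mul, abs_mul]
    rw [abs_of_pos (by positivity : 0 < α / (|c| + 1)), abs_of_pos hα, div_mul_eq_mul_div,
      div_le_iff₀ (by positivity)]
    nlinarith [mul_nonneg hα.le (abs_nonneg (v ω)), abs_nonneg c]

/-- The Orlicz space `L^Φ(p)`, `Φ = cosh - 1`, to be normed by the Luxemburg norm. -/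
def Orlicz (p : PosDensity μ) : Type _ := orliczSubmodule p

namespace Orlicz

variable {p : PosDensity μ}

instance : AddCommGroup (Orlicz p) := inferInstanceAs (AddCommGroup (orliczSubmodule p))

instance : Module ℝ (Orlicz p) := inferInstanceAs (Module ℝ (orliczSubmodule p))

/-- The underlying class of random variables. -/
def toAE : Orlicz p →ₗ[ℝ] Ω →ₘ[p.meas] ℝ := (orliczSubmodule p).subtype

instance : CoeFun (Orlicz p) (fun _ => Ω → ℝ) := ⟨fun v => (toAE v : Ω → ℝ)⟩

theorem toAE_injective : Function.Injective (toAE (p := p)) := Subtype.val_injective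

theorem coeFn_add (v w : Orlicz p) : ⇑(v + w) =ᵐ[p.meas] ⇑v + ⇑w := by
  rw [map_add]; exact AEEqFun.coeFn_add _ _

theorem coeFn_smul (c : ℝ) (v : Orlicz p) : ⇑(c • v) =ᵐ[p.meas] c • ⇑v := by
  rw [map_smul]; exact AEEqFun.coeFn_smul _ _

theorem stronglyMeasurable (v : Orlicz p) : StronglyMeasurable v :=
  AEEqFun.stronglyMeasurable _

theorem exists_modular_lt_top (v : Orlicz p) :
    ∃ α : ℝ, 0 < α ∧ modular p (fun ω => α * v ω) < ∞ := v.2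

theorem memLp_two (v : Orlicz p) : MemLp v 2 p.meas := by
  obtain ⟨α, hα, h⟩ := v.exists_modular_lt_top
  rw [memLp_two_iff_integrable_sq v.stronglyMeasurable.aestronglyMeasurable]
  have h1 : Integrable (fun ω => Phi (α * v ω)) p.meas := by
    refine ⟨(continuous_Phi.comp_stronglyMeasurable
      (v.stronglyMeasurable.const_mul α)).aestronglyMeasurable, ?_⟩
    rw [hasFiniteIntegral_iff_ofReal (.of_forall fun _ => Phi_nonneg _)]
    exact h
  refine (h1.const_mul (4 / α ^ 2)).mono'
    (v.stronglyMeasurable.pow 2).aestronglyMeasurable (.of_forall fun ω => ?_)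
  have := sq_le_Phi (α * v ω)
  rw [Real.norm_eq_abs, abs_of_nonneg (sq_nonneg _), div_mul_eq_mul_div,
    le_div_iff₀ (by positivity)]
  linarith [mul_pow α (v ω) 2]

theorem integrable (v : Orlicz p) : Integrable v p.meas :=
  v.memLp_two.integrable (by norm_num)

/-- The closed unit ball `{v | E_p[Φ(v)] ≤ 1}` of the Luxemburg norm. -/
def unitBall (p : PosDensity μ) : Set (Orlicz p) := {v | modular p v ≤ 1}

theorem convex_unitBall : Convex ℝ (unitBall p) := by
  intro v hv w hw a b ha hb hab
  have h : ⇑(a • v + b • w) =ᵐ[p.meas] fun ω => a * v ω + b * w ω := by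
    filter_upwards [coeFn_add (a • v) (b • w), coeFn_smul a v, coeFn_smul b w] with ω h1 h2 h3
    rw [h1, Pi.add_apply, h2, h3, Pi.smul_apply, Pi.smul_apply, smul_eq_mul, smul_eq_mul]
  change modular p _ ≤ 1
  rw [modular_congr p h]
  refine (modular_convex p ha hb hab v.stronglyMeasurable.aestronglyMeasurable).trans ?_
  calc _ ≤ ENNReal.ofReal a * 1 + ENNReal.ofReal b * 1 := by
        gcongr
        · exact hv
        · exact hw
    _ = 1 := by
        rw [mul_one, mul_one, ← ENNReal.ofReal_add ha hb, hab, ENNReal.ofReal_one]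

theorem smul_mem_unitBall {v : Orlicz p} (hv : v ∈ unitBall p) {c : ℝ} (hc : |c| ≤ 1) :
    c • v ∈ unitBall p := by
  refine (modular_mono p ((coeFn_smul c v).mono fun ω h => ?_)).trans hv
  simp only [h, Pi.smul_apply, smul_eq_mul, abs_mul]
  exact mul_le_of_le_one_left (abs_nonneg _) hc

theorem balanced_unitBall : Balanced ℝ (unitBall p) := by
  rintro c hc _ ⟨v, hv, rfl⟩
  exact smul_mem_unitBall hv (by simpa using hc)

theorem exists_smul_mem_unitBall (v : Orlicz p) : ∃ r : ℝ, 0 < r ∧ r • v ∈ unitBall p := by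
  obtain ⟨α, hα, h⟩ := v.exists_modular_lt_top
  set I := modular p (fun ω => α * v ω)
  set s : ℝ := 1 / (I.toReal + 1)
  have hI : 0 ≤ I.toReal := ENNReal.toReal_nonneg
  have hs : 0 < s := by positivity
  have hs1 : s ≤ 1 := by
    rw [div_le_one (by positivity)]; linarith
  refine ⟨s * α, by positivity, ?_⟩
  change modular p _ ≤ 1
  have he : ⇑((s * α) • v) =ᵐ[p.meas] fun ω => s * (α * v ω) + (1 - s) * (0 : ℝ) :=
    (coeFn_smul (s * α) v).mono fun ω h => by
      rw [h, Pi.smul_apply, smul_eq_mul]; ring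
  rw [modular_congr p he]
  refine (modular_convex p hs.le (by linarith) (by ring)
    (v.stronglyMeasurable.const_mul α).aestronglyMeasurable (w := fun _ => 0)).trans ?_
  have h0 : modular p (fun _ => (0 : ℝ)) = 0 := by simp [modular, Phi_zero]
  rw [h0, mul_zero, add_zero]
  change ENNReal.ofReal s * I ≤ 1
  rw [← ENNReal.ofReal_toReal h.ne, ← ENNReal.ofReal_mul hs.le]
  refine ENNReal.ofReal_le_one.2 ?_
  change 1 / (I.toReal + 1) * I.toReal ≤ 1
  rw [one_div, inv_mul_le_iff₀ (by positivity)]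
  linarith

theorem absorbent_unitBall : Absorbent ℝ (unitBall p) := by
  rw [absorbent_iff_inv_smul]
  intro v
  obtain ⟨r, hr, h⟩ := v.exists_smul_mem_unitBall
  filter_upwards [tendsto_norm_cobounded_atTop.eventually_ge_atTop r⁻¹] with c hc
  have hc0 : 0 < |c| := (inv_pos.2 hr).trans_le hc
  have : c⁻¹ • v = (c⁻¹ * r⁻¹) • (r • v) := by
    rw [smul_smul, mul_assoc, inv_mul_cancel₀ hr.ne', mul_one]
  rw [this]
  refine smul_mem_unitBall h ?_
  rw [abs_mul, abs_inv, abs_inv, abs_of_pos hr, inv_mul_le_iff₀ hc0, mul_one]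
  exact hc

/-- The Luxemburg norm, i.e. the gauge of the set `{v | E_p[Φ(v)] ≤ 1}`. -/
instance : Norm (Orlicz p) := ⟨gauge (unitBall p)⟩

theorem norm_def (v : Orlicz p) : ‖v‖ = gauge (unitBall p) v := rfl

theorem eq_zero_of_norm_eq_zero {v : Orlicz p} (hv : ‖v‖ = 0) : v = 0 := by
  have h1 : ∀ r : ℝ, 0 < r → ∫ ω, v ω ^ 2 ∂p.meas ≤ 4 * r ^ 2 := by
    intro r hr
    obtain ⟨b, hb0, hbr, hb⟩ := exists_lt_of_gauge_lt absorbent_unitBall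
      (show gauge (unitBall p) v < r by rw [← norm_def, hv]; exact hr)
    obtain ⟨w, hw, rfl⟩ := hb
    have hw' : ∫ ω, Phi (w ω) ∂p.meas ≤ 1 := by
      rw [integral_eq_lintegral_of_nonneg_ae (.of_forall fun _ => Phi_nonneg _)
        (continuous_Phi.comp_stronglyMeasurable w.stronglyMeasurable).aestronglyMeasurable]
      exact ENNReal.toReal_le_of_le_ofReal zero_le_one (by rw [ENNReal.ofReal_one]; exact hw)
    have hi : Integrable (fun ω => Phi (w ω)) p.meas := by
      refine ⟨(continuous_Phi.comp_stronglyMeasurable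
        w.stronglyMeasurable).aestronglyMeasurable, ?_⟩
      rw [hasFiniteIntegral_iff_ofReal (.of_forall fun _ => Phi_nonneg _)]
      exact lt_of_le_of_lt hw ENNReal.one_lt_top
    calc ∫ ω, (b • w) ω ^ 2 ∂p.meas = ∫ ω, b ^ 2 * w ω ^ 2 ∂p.meas :=
          integral_congr_ae ((coeFn_smul b w).mono fun ω h => by
            change (b • w) ω ^ 2 = _
            rw [h, Pi.smul_apply, smul_eq_mul, mul_pow])
      _ ≤ ∫ ω, b ^ 2 * (4 * Phi (w ω)) ∂p.meas := by
          refine integral_mono (w.memLp_two.integrable_sq.const_mul _)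
            ((hi.const_mul 4).const_mul _) fun ω => ?_
          exact mul_le_mul_of_nonneg_left (sq_le_Phi _) (sq_nonneg _)
      _ = b ^ 2 * (4 * ∫ ω, Phi (w ω) ∂p.meas) := by
          rw [integral_const_mul, integral_const_mul]
      _ ≤ r ^ 2 * (4 * 1) := by
          have : 0 ≤ ∫ ω, Phi (w ω) ∂p.meas := integral_nonneg fun _ => Phi_nonneg _
          gcongr
      _ = 4 * r ^ 2 := by ring
  have h2 : ∫ ω, v ω ^ 2 ∂p.meas ≤ 0 := by
    refine le_of_forall_pos_le_add fun ε hε => ?_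
    have := h1 (Real.sqrt (ε / 4)) (by positivity)
    rw [Real.sq_sqrt (by positivity)] at this
    linarith
  have h3 : ∫ ω, v ω ^ 2 ∂p.meas = 0 := le_antisymm h2 (integral_nonneg fun _ => sq_nonneg _)
  rw [integral_eq_zero_iff_of_nonneg (fun _ => sq_nonneg _) v.memLp_two.integrable_sq] at h3
  refine toAE_injective (AEEqFun.ext ?_)
  rw [map_zero]
  filter_upwards [h3, AEEqFun.coeFn_zero (β := ℝ) (μ := p.meas)] with ω h4 h5
  rw [h5]
  simpa using h4

theorem normCore (p : PosDensity μ) : NormedSpace.Core ℝ (Orlicz p) where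
  norm_nonneg v := gauge_nonneg v
  norm_smul c v := gauge_smul balanced_unitBall c v
  norm_triangle v w := gauge_add_le convex_unitBall absorbent_unitBall v w
  norm_eq_zero_iff v := ⟨eq_zero_of_norm_eq_zero, fun h => by rw [h, norm_def, gauge_zero]⟩

instance : NormedAddCommGroup (Orlicz p) := NormedAddCommGroup.ofCore (normCore p)

instance : NormedSpace ℝ (Orlicz p) := NormedSpace.ofCore (normCore p)

end Orlicz

/-- The tangent space `T_p𝓜 = B_p = L^Φ_0(p)` of centered random variables, with the Luxemburg
norm; it is also the model space of the chart at `p`. -/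
def tangentSubmodule (p : PosDensity μ) : Submodule ℝ (Orlicz p) where
  carrier := {v | ∫ ω, v ω ∂p.meas = 0}
  zero_mem' := by
    change ∫ ω, (0 : Orlicz p) ω ∂p.meas = 0
    rw [map_zero, integral_congr_ae AEEqFun.coeFn_zero]
    simp
  add_mem' {v w} hv hw := by
    change ∫ ω, (v + w) ω ∂p.meas = 0
    rw [integral_congr_ae (Orlicz.coeFn_add v w)]
    simp only [Pi.add_apply]
    rw [integral_add v.integrable w.integrable, hv, hw, add_zero]
  smul_mem' c v hv := by
    change ∫ ω, (c • v) ω ∂p.meas = 0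
    rw [integral_congr_ae (Orlicz.coeFn_smul c v)]
    simp only [Pi.smul_apply, smul_eq_mul]
    rw [integral_const_mul, hv, mul_zero]

/-- `B_p`, the space of centered elements of `L^Φ(p)`. -/
abbrev B (p : PosDensity μ) : Type _ := tangentSubmodule p

instance (p : PosDensity μ) : CoeFun (B p) (fun _ => Ω → ℝ) := ⟨fun u => (u : Orlicz p)⟩

/-- The constant random variables, as elements of `L^Φ(p)`. -/
def Orlicz.const (p : PosDensity μ) (c : ℝ) : Orlicz p :=
  ⟨AEEqFun.const Ω c, 1, one_pos, by
    rw [modular_congr p (w := fun _ => c)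
      ((AEEqFun.coeFn_const Ω c).mono fun ω h => by simp [h])]
    simp [modular]⟩

theorem Orlicz.coeFn_const (p : PosDensity μ) (c : ℝ) :
    ⇑(Orlicz.const p c) =ᵐ[p.meas] fun _ => c :=
  AEEqFun.coeFn_const Ω c

theorem sub_const_mem (p : PosDensity μ) (v : Orlicz p) :
    v - Orlicz.const p (∫ ω, v ω ∂p.meas) ∈ tangentSubmodule p := by
  change ∫ ω, (v - Orlicz.const p (∫ ω, v ω ∂p.meas)) ω ∂p.meas = 0
  rw [map_sub, integral_congr_ae (AEEqFun.coeFn_sub _ _)]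
  simp only [Pi.sub_apply]
  rw [integral_sub v.integrable (Orlicz.integrable _),
    integral_congr_ae (Orlicz.coeFn_const p (∫ ω, v ω ∂p.meas))]
  simp

open Classical in
/-- `f - E_p[f]` as an element of `B_p`, for a random variable `f` in `L^Φ(p)`
(and `0` if `f` is not in `L^Φ(p)`). -/
def centered (p : PosDensity μ) (f : Ω → ℝ) : B p :=
  if h : ∃ v : Orlicz p, v =ᵐ[p.meas] f then
    ⟨h.choose - Orlicz.const p (∫ ω, h.choose ω ∂p.meas), sub_const_mem p h.choose⟩
  else 0

/-! ### The exponential manifold -/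

/-- The cumulant generating functional `K_p(u) = log E_p[e^u]`. -/
def cumulant (p : PosDensity μ) (u : B p) : ℝ := Real.log (∫ ω, Real.exp (u ω) ∂p.meas)

/-- `𝓢_p`: the interior, in `B_p`, of the proper domain of `K_p`. -/
def chartTarget (p : PosDensity μ) : Set (B p) :=
  interior {u | Integrable (fun ω => Real.exp (u ω)) p.meas}

theorem integrable_patch (p : PosDensity μ) (u : B p)
    (h : Integrable (fun ω => Real.exp (u ω)) p.meas) :
    Integrable (fun ω => Real.exp (u ω - cumulant p u) * p.dens ω) μ := by
  rw [← p.integrable_meas_iff]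
  simp only [Real.exp_sub]
  exact h.div_const _

theorem integral_patch (p : PosDensity μ) (u : B p)
    (h : Integrable (fun ω => Real.exp (u ω)) p.meas) :
    ∫ ω, Real.exp (u ω - cumulant p u) * p.dens ω ∂μ = 1 := by
  have hpos : 0 < ∫ ω, Real.exp (u ω) ∂p.meas := integral_exp_pos h
  rw [← p.integral_meas]
  simp only [Real.exp_sub]
  rw [integral_div, cumulant, Real.exp_log hpos, div_self hpos.ne']

open Classical in
/-- The patch `e_p(u) = e^{u - K_p(u)} · p` (with value `p` outside the proper domain of `K_p`). -/
def patch (p : PosDensity μ) (u : B p) : PosDensity μ :=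
  if h : Integrable (fun ω => Real.exp (u ω)) p.meas then
    { dens := (integrable_patch p u h).toL1 _
      pos := by
        filter_upwards [(integrable_patch p u h).coeFn_toL1, p.pos] with ω h1 h2
        rw [h1]
        positivity
      integral_eq_one := by
        rw [integral_congr_ae (integrable_patch p u h).coeFn_toL1, integral_patch p u h] }
  else p

/-- The maximal exponential model `𝓔(p)`, the domain of the chart at `p`. -/
def maxExp (p : PosDensity μ) : Set (PosDensity μ) := patch p '' chartTarget p

/-- The chart `s_p(q) = log (q / p) - E_p[log (q / p)]`, for `q ∈ 𝓔(p)`. -/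
def chart (p q : PosDensity μ) : B p :=
  centered p fun ω => Real.log (q.dens ω / p.dens ω)

/-- `γ` is a curve in the exponential manifold with `γ(0) = p` which is differentiable at `0` with
velocity `δγ(0) = w ∈ T_p𝓜`, the derivative of its coordinate in the chart at `p`. -/
structure IsCurveAt (γ : ℝ → PosDensity μ) (p : PosDensity μ) (w : B p) : Prop where
  start : γ 0 = p
  mem : ∀ᶠ t in 𝓝 0, γ t ∈ maxExp p
  velocity : HasDerivAt (fun t => chart p (γ t)) w 0

/-! ### The Hilbert bundle -/

/-- The space `L²_0(p)` of centered square integrable random variables. -/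
def hilbertSubmodule (p : PosDensity μ) : Submodule ℝ (Lp ℝ 2 p.meas) where
  carrier := {v | ∫ ω, v ω ∂p.meas = 0}
  zero_mem' := by
    change ∫ ω, (0 : Lp ℝ 2 p.meas) ω ∂p.meas = 0
    rw [integral_congr_ae (Lp.coeFn_zero ℝ 2 p.meas)]
    simp
  add_mem' {v w} hv hw := by
    change ∫ ω, (v + w) ω ∂p.meas = 0
    rw [integral_congr_ae (Lp.coeFn_add v w)]
    simp only [Pi.add_apply]
    rw [integral_add ((Lp.memLp v).integrable (by norm_num))
      ((Lp.memLp w).integrable (by norm_num)), hv, hw, add_zero]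
  smul_mem' c v hv := by
    change ∫ ω, (c • v) ω ∂p.meas = 0
    rw [integral_congr_ae (Lp.coeFn_smul c v)]
    simp only [Pi.smul_apply, smul_eq_mul]
    rw [integral_const_mul, hv, mul_zero]

/-- The fiber `H_p = L²_0(p)` of the Hilbert bundle `H𝓜`. -/
abbrev H (p : PosDensity μ) : Type _ := hilbertSubmodule p

instance (p : PosDensity μ) : CoeFun (H p) (fun _ => Ω → ℝ) := ⟨fun u => (u : Lp ℝ 2 p.meas)⟩

/-- `√(q / p)`. -/
def sqrtRatio (q p : PosDensity μ) (ω : Ω) : ℝ := Real.sqrt (q.dens ω / p.dens ω)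

theorem stronglyMeasurable_sqrtRatio (q p : PosDensity μ) :
    StronglyMeasurable (sqrtRatio q p) :=
  ((Lp.stronglyMeasurable q.dens).measurable.div
    (Lp.stronglyMeasurable p.dens).measurable).sqrt.stronglyMeasurable

theorem memLp_sqrtRatio_mul (q p : PosDensity μ) {f : Ω → ℝ} (hf : StronglyMeasurable f)
    (h : MemLp f 2 q.meas) : MemLp (fun ω => sqrtRatio q p ω * f ω) 2 p.meas := by
  have hm : AEStronglyMeasurable (fun ω => sqrtRatio q p ω * f ω) p.meas :=
    ((stronglyMeasurable_sqrtRatio q p).mul hf).aestronglyMeasurable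
  rw [memLp_two_iff_integrable_sq hm, p.integrable_meas_iff]
  refine (q.integrable_meas_iff.1 h.integrable_sq).congr ?_
  filter_upwards [q.pos, p.pos] with ω hq hp
  rw [mul_pow, sqrtRatio, Real.sq_sqrt (div_nonneg hq.le hp.le)]
  field_simp

theorem memLp_sqrtRatio (q p : PosDensity μ) : MemLp (sqrtRatio q p) 2 p.meas := by
  simpa using memLp_sqrtRatio_mul q p (f := fun _ => 1) stronglyMeasurable_const (memLp_const 1)

/-- The right-hand side of
`U_q^p u = √(q/p) u - (1 + E_p[√(q/p)])⁻¹ (1 + √(q/p)) E_p[√(q/p) u]`. -/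
def transportFun (q p : PosDensity μ) (u : Ω → ℝ) (ω : Ω) : ℝ :=
  sqrtRatio q p ω * u ω -
    (1 + ∫ x, sqrtRatio q p x ∂p.meas)⁻¹ * (1 + sqrtRatio q p ω) *
      ∫ x, sqrtRatio q p x * u x ∂p.meas

theorem memLp_transportFun (q p : PosDensity μ) (u : H q) :
    MemLp (transportFun q p u) 2 p.meas := by
  refine (memLp_sqrtRatio_mul q p (Lp.stronglyMeasurable _) (Lp.memLp u.1)).sub ?_
  exact ((((memLp_const (1 : ℝ)).add (memLp_sqrtRatio q p)).const_mul
    (1 + ∫ x, sqrtRatio q p x ∂p.meas)⁻¹).mul_const (∫ x, sqrtRatio q p x * u x ∂p.meas))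

theorem integral_transportFun (q p : PosDensity μ) (u : H q) :
    ∫ ω, transportFun q p u ω ∂p.meas = 0 := by
  have h1 : Integrable (fun ω => sqrtRatio q p ω * u ω) p.meas :=
    (memLp_sqrtRatio_mul q p (Lp.stronglyMeasurable _) (Lp.memLp u.1)).integrable (by norm_num)
  have h2 : Integrable (sqrtRatio q p) p.meas := (memLp_sqrtRatio q p).integrable (by norm_num)
  have h3 : 0 < 1 + ∫ x, sqrtRatio q p x ∂p.meas := by
    have : 0 ≤ ∫ x, sqrtRatio q p x ∂p.meas := integral_nonneg fun _ => Real.sqrt_nonneg _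
    linarith
  have h4 : Integrable (fun ω => (1 + ∫ x, sqrtRatio q p x ∂p.meas)⁻¹ * (1 + sqrtRatio q p ω) *
      ∫ x, sqrtRatio q p x * u x ∂p.meas) p.meas :=
    (((integrable_const 1).add h2).const_mul _).mul_const _
  simp only [transportFun]
  rw [integral_sub h1 h4,
    integral_mul_const, integral_const_mul, integral_add (integrable_const 1) h2]
  simp only [integral_const, probReal_univ, smul_eq_mul, mul_one]
  rw [inv_mul_cancel₀ h3.ne', one_mul, sub_self]

/-- The transport `U_q^p : H_q → H_p`. -/
def transport (q p : PosDensity μ) (u : H q) : H p :=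
  ⟨(memLp_transportFun q p u).toLp _, by
    change ∫ ω, (memLp_transportFun q p u).toLp _ ω ∂p.meas = 0
    rw [integral_congr_ae (memLp_transportFun q p u).coeFn_toLp, integral_transportFun]⟩

/-! ### Vector fields, functions, and their differentiability at a point

Everything is read in the chart of the exponential manifold centered at the point. As all notions
are pointwise, values far from the point play no role, which covers local sections as well. -/

/-- Sections of the tangent bundle `T𝓜`. -/
abbrev TField (μ : Measure Ω) : Type _ := ∀ p : PosDensity μ, B p

/-- Sections of the Hilbert bundle `H𝓜`. -/
abbrev HField (μ : Measure Ω) : Type _ := ∀ p : PosDensity μ, H p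

/-- A section of `H𝓜` in the bundle chart `(q, v) ↦ (s_p(q), U_q^p v)`. -/
def HField.coord (F : HField μ) (p : PosDensity μ) (u : B p) : H p :=
  transport (patch p u) p (F (patch p u))

/-- A section of `T𝓜` in the bundle chart `(q, v) ↦ (s_p(q), v - E_p[v])`. -/
def TField.coord (G : TField μ) (p : PosDensity μ) (u : B p) : B p :=
  centered p (G (patch p u))

/-- `F` is of class `C^n` at `p`. -/
def HField.CDiffAt (n : WithTop ℕ∞) (F : HField μ) (p : PosDensity μ) : Prop :=
  ContDiffAt ℝ n (HField.coord F p) 0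

/-- `G` is of class `C^n` at `p`. -/
def TField.CDiffAt (n : WithTop ℕ∞) (G : TField μ) (p : PosDensity μ) : Prop :=
  ContDiffAt ℝ n (TField.coord G p) 0

/-- `F` is differentiable at `p`. -/
def HField.DiffAt (F : HField μ) (p : PosDensity μ) : Prop :=
  DifferentiableAt ℝ (HField.coord F p) 0

/-- The real function `φ` on the exponential manifold is differentiable at `p`. -/
def ScalarDiffAt (φ : PosDensity μ → ℝ) (p : PosDensity μ) : Prop :=
  DifferentiableAt ℝ (fun u : B p => φ (patch p u)) 0

/-- The derivative `D_G φ` of a real function `φ` along the vector field `G`. -/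
def scalarDeriv (G : TField μ) (φ : PosDensity μ → ℝ) (p : PosDensity μ) : ℝ :=
  fderiv ℝ (fun u : B p => φ (patch p u)) 0 (G p)

/-- `D` is a covariant derivative on the Hilbert bundle `H𝓜` over the exponential manifold:
`D_G F` at `p` is linear and continuous in the tangent vector `G(p)`, additive in `F`, satisfies
the Leibniz rule, and is of class `C^n` when `G` is of class `C^n` and `F` of class `C^{n+1}`. -/
structure IsCovariantDerivative (D : TField μ → HField μ → HField μ) : Prop where
  tensorial : ∀ (F : HField μ) (p : PosDensity μ), HField.DiffAt F p →
    ∃ L : B p →L[ℝ] H p, ∀ G : TField μ, D G F p = L (G p)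
  add : ∀ (G : TField μ) (F₁ F₂ : HField μ) (p : PosDensity μ),
    HField.DiffAt F₁ p → HField.DiffAt F₂ p → D G (F₁ + F₂) p = D G F₁ p + D G F₂ p
  leibniz : ∀ (G : TField μ) (F : HField μ) (φ : PosDensity μ → ℝ) (p : PosDensity μ),
    HField.DiffAt F p → ScalarDiffAt φ p →
      D G (fun q => φ q • F q) p = scalarDeriv G φ p • F p + φ p • D G F p
  contDiff : ∀ (n : ℕ∞) (G : TField μ) (F : HField μ) (p : PosDensity μ),
    TField.CDiffAt n G p → HField.CDiffAt (n + 1) F p → HField.CDiffAt n (D G F) p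

/-! ### The metric derivative -/

/-- `d/dt U_{p(t)}^p F(p(t)) |_{t=0} = D` in `H_p` for all curves with `p(0) = p`, `δp(0) = w`. -/
def HasMetricDerivAt (F : HField μ) (p : PosDensity μ) (w : B p) (D : H p) : Prop :=
  ∀ γ : ℝ → PosDensity μ, IsCurveAt γ p w →
    HasDerivAt (fun t => transport (γ t) p (F (γ t))) D 0

open Classical in
/-- The vector field `D_G F(p) = d/dt U_{p(t)}^p F(p(t)) |_{t=0}`, where `p(t)` is a curve with
`p(0) = p` and `δp(0) = G(p)`. -/
def metricDeriv (G : TField μ) (F : HField μ) : HField μ := fun p =>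
  if h : ∃ D : H p, HasMetricDerivAt F p (G p) D then h.choose else 0

/-- `f' = ḟ(0)` for a curve `f` of random variables, in the topology of `L⁰` (convergence in
probability): `(f(t) - f(0)) / t → f'` as `t → 0`. -/
def HasDotAtZero (p : PosDensity μ) (f : ℝ → Ω → ℝ) (f' : Ω → ℝ) : Prop :=
  AEStronglyMeasurable f' p.meas ∧
    TendstoInMeasure p.meas (fun t ω => (f t ω - f 0 ω) / t) (𝓝[≠] 0) f'

/-- `D = f' + ½ f w - E_p[f' + ½ f w]`, where `f' + ½ f w` is in `L²(p)`. -/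
def IsExplicitForm (p : PosDensity μ) (f f' w D : Ω → ℝ) : Prop :=
  MemLp (fun ω => f' ω + 1 / 2 * f ω * w ω) 2 p.meas ∧
    ∀ᵐ ω ∂p.meas, D ω = f' ω + 1 / 2 * f ω * w ω - ∫ x, (f' x + 1 / 2 * f x * w x) ∂p.meas

end ExpManifold

end

open ExpManifold

open scoped InnerProductSpace

/-! Multiplication by `√(q/p)` is an isometry `L²(q) → L²(p)` (`mulSqrt`). It sends the constant `1`
to the half-density `√(q/p)`, a unit vector of `L²(p)`, and the fiber `H_q = 1^⊥` into the
orthogonal complement of that vector, that is, into the tangent space of the unit sphere of `L²(p)`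
there. Under this identification `U_q^p` is the parallel transport of the sphere from `√(q/p)` to
`1` along a great circle (`coe_transport`). It is isometric and invertible, and differentiating it
at `q = p` gives the orthogonal projection onto `1^⊥` of the derivative of the half-density field `X
= √(q/p) F(q)` (`hasFDerivAt_sphereTransport`). All the claims become calculus for `X` in the fixed
space `L²(p)`.

The analytic input is that `v ↦ e^{v/2}` is analytic from a ball of `L^Φ(p)` to `L²(p)`: the `k`-th
term of its series has norm at most `2^k`, by the term of order `2k` in the series of `cosh` and the
inequality of means (`norm_toLp_prod_le`). The half-density of `e_p(u)` is the normalization of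
`e^{u/2}`, hence smooth in `u`, with derivative `w/2` at `0` in the direction `w`
(`coeFn_fderiv_halfDensity_zero`).

The chain rule identifies `D_G F(p)` with the Fréchet derivative of the coordinate of `F` at `0`,
applied to `G(p)`; continuity, additivity and the Leibniz rule follow, and metricity follows from
the isometry of the transport. For regularity, `D_G F` must be known at points `q = e_p(u)` near
`p`, where it is defined through the chart at `q`. The change of charts is affine
(`exists_chart_change`), so there `D_G F(q)` is the projection of the derivative at `u` of the same
field `X` on the chart at `p` (`metricDeriv_of_halfField`). The explicit formula is the product rule
for `X = √(p(t)/p) F(t)`. Since `F(t)` is not a curve in a fixed Hilbert space, it is read on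
difference quotients, in probability (`exists_explicitForm`). -/

namespace ExpManifold

/-! ### Parallel transport on the unit sphere of a Hilbert space -/

section Sphere

variable {E : Type*} [NormedAddCommGroup E] [InnerProductSpace ℝ E]

/-- The transport from the orthogonal complement of `b` to that of `a`, for unit vectors `a`, `b`
which are not antipodal, along the great circle through them. -/
noncomputable def sphereTransport (a b x : E) : E := x - ((1 + ⟪a, b⟫_ℝ)⁻¹ * ⟪a, x⟫_ℝ) • (a + b)

/-- Since `⟪b, a + b⟫ = 1 + ⟪a, b⟫`, the transported vector pairs with `b` to `-⟪a, x⟫`, so the way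
back adds the multiple of `a + b` that was subtracted. -/
theorem sphereTransport_sphereTransport {a b x : E} (hb : ‖b‖ = 1)
    (hab : 1 + ⟪a, b⟫_ℝ ≠ 0) (hx : ⟪b, x⟫_ℝ = 0) :
    sphereTransport b a (sphereTransport a b x) = x := by
  have h1 : ⟪b, a + b⟫_ℝ = 1 + ⟪a, b⟫_ℝ := by
    rw [inner_add_right, real_inner_self_eq_norm_sq, hb, real_inner_comm]; ring
  simp only [sphereTransport, inner_sub_right, inner_smul_right, hx, h1, real_inner_comm a b]
  rw [show (1 + ⟪a, b⟫_ℝ)⁻¹ * (0 - (1 + ⟪a, b⟫_ℝ)⁻¹ * ⟪a, x⟫_ℝ * (1 + ⟪a, b⟫_ℝ)) =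
    -((1 + ⟪a, b⟫_ℝ)⁻¹ * ⟪a, x⟫_ℝ) by field_simp; ring, neg_smul, add_comm b a]
  abel

theorem inner_sphereTransport {a b x y : E} (ha : ‖a‖ = 1) (hb : ‖b‖ = 1)
    (hab : 1 + ⟪a, b⟫_ℝ ≠ 0) (hx : ⟪b, x⟫_ℝ = 0) (hy : ⟪b, y⟫_ℝ = 0) :
    ⟪sphereTransport a b x, sphereTransport a b y⟫_ℝ = ⟪x, y⟫_ℝ := by
  have haa : ⟪a, a⟫_ℝ = 1 := by rw [real_inner_self_eq_norm_sq, ha, one_pow]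
  have hbb : ⟪b, b⟫_ℝ = 1 := by rw [real_inner_self_eq_norm_sq, hb, one_pow]
  simp only [sphereTransport, inner_sub_left, inner_sub_right, inner_smul_left, inner_smul_right,
    inner_add_left, inner_add_right, haa, hbb, hx, hy, real_inner_comm a b, real_inner_comm a x,
    real_inner_comm b x, RCLike.conj_to_real]
  field_simp
  ring

theorem sphereTransport_self {a x : E} (hx : ⟪a, x⟫_ℝ = 0) : sphereTransport a a x = x := by
  simp [sphereTransport, hx]

variable {V : Type*} [NormedAddCommGroup V] [NormedSpace ℝ V]

theorem contDiffAt_sphereTransport {n : WithTop ℕ∞} {a b x : V → E} {v : V}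
    (ha : ContDiffAt ℝ n a v) (hb : ContDiffAt ℝ n b v) (hx : ContDiffAt ℝ n x v)
    (hab : 1 + ⟪a v, b v⟫_ℝ ≠ 0) :
    ContDiffAt ℝ n (fun w => sphereTransport (a w) (b w) (x w)) v :=
  hx.sub ((((contDiffAt_const.add (ha.inner ℝ hb)).inv hab).mul (ha.inner ℝ hx)).smul (ha.add hb))

theorem differentiableAt_sphereTransport {a b x : V → E} {v : V}
    (ha : DifferentiableAt ℝ a v) (hb : DifferentiableAt ℝ b v) (hx : DifferentiableAt ℝ x v)
    (hab : 1 + ⟪a v, b v⟫_ℝ ≠ 0) :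
    DifferentiableAt ℝ (fun w => sphereTransport (a w) (b w) (x w)) v :=
  hx.sub (((((differentiableAt_const _).add (ha.inner ℝ hb)).inv hab).mul (ha.inner ℝ hx)).smul
    (ha.add hb))

/-- The derivative of the transport to a fixed fiber is the orthogonal projection of the
derivative. -/
theorem hasFDerivAt_sphereTransport {a : E} {b x : V → E} {v : V} {x' : V →L[ℝ] E}
    (ha : ‖a‖ = 1) (hb : DifferentiableAt ℝ b v) (hx : HasFDerivAt x x' v) (hv : b v = a)
    (hxv : ⟪a, x v⟫_ℝ = 0) :
    HasFDerivAt (fun w => sphereTransport a (b w) (x w))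
      (x' - ((innerSL ℝ a).comp x').smulRight a) v := by
  have haa : ⟪a, a⟫_ℝ = 1 := by rw [real_inner_self_eq_norm_sq, ha, one_pow]
  have h0 : 1 + ⟪a, b v⟫_ℝ ≠ 0 := by rw [hv, haa]; norm_num
  have h1 : HasFDerivAt (fun w => (1 + ⟪a, b w⟫_ℝ)⁻¹) _ v :=
    ((((differentiableAt_const (1 : ℝ)).add
      ((differentiableAt_const a).inner ℝ hb)).inv h0)).hasFDerivAt
  have h2 : HasFDerivAt (fun w => ⟪a, x w⟫_ℝ) ((innerSL ℝ a).comp x') v :=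
    (innerSL ℝ a).hasFDerivAt.comp v hx
  -- The factor `⟪a, x w⟫` vanishes at `v`, so only its own derivative survives in the product rule.
  -- It comes with `(1 + 1)⁻¹` and the vector `a + a`.
  refine (hx.sub ((h1.mul h2).smul ((hasFDerivAt_const a v).add hb.hasFDerivAt))).congr_fderiv ?_
  ext w
  simp [hv, hxv, ha]
  rw [← add_smul]
  congr 1
  ring

end Sphere

/-! ### The half-density isometries -/

variable {Ω : Type*} [MeasurableSpace Ω] {μ : Measure Ω}

theorem inner_L2 {p : PosDensity μ} (f g : Lp ℝ 2 p.meas) :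
    ⟪f, g⟫_ℝ = ∫ ω, f ω * g ω ∂p.meas := by
  rw [L2.inner_def]
  simp [mul_comm]

theorem ae_meas_iff (p : PosDensity μ) {P : Ω → Prop} :
    (∀ᵐ ω ∂p.meas, P ω) ↔ ∀ᵐ ω ∂μ, P ω :=
  ⟨fun h => p.absolutelyContinuous_meas.ae_le h, fun h => p.meas_absolutelyContinuous.ae_le h⟩

theorem ae_meas_of_ae_meas {p : PosDensity μ} (q : PosDensity μ) {P : Ω → Prop}
    (h : ∀ᵐ ω ∂p.meas, P ω) : ∀ᵐ ω ∂q.meas, P ω :=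
  (ae_meas_iff q).2 ((ae_meas_iff p).1 h)

/-- The constant random variable `1`. -/
noncomputable def oneL2 (p : PosDensity μ) : Lp ℝ 2 p.meas := Lp.const 2 p.meas 1

theorem coeFn_oneL2 (p : PosDensity μ) : oneL2 p =ᵐ[p.meas] fun _ => 1 :=
  Lp.coeFn_const 2 p.meas 1

theorem inner_oneL2 {p : PosDensity μ} (f : Lp ℝ 2 p.meas) : ⟪oneL2 p, f⟫_ℝ = ∫ ω, f ω ∂p.meas := by
  rw [inner_L2]
  exact integral_congr_ae ((coeFn_oneL2 p).mono fun ω h => by simp [h])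

theorem norm_oneL2 (p : PosDensity μ) : ‖oneL2 p‖ = 1 := by
  have h : ‖oneL2 p‖ ^ 2 = 1 := by
    rw [← real_inner_self_eq_norm_sq, inner_oneL2, integral_congr_ae (coeFn_oneL2 p)]
    simp
  exact (pow_eq_one_iff_of_nonneg (norm_nonneg _) two_ne_zero).1 h

theorem inner_oneL2_coe {p : PosDensity μ} (f : H p) : ⟪oneL2 p, (f : Lp ℝ 2 p.meas)⟫_ℝ = 0 := by
  rw [inner_oneL2]
  exact f.2

theorem mul_sqrtRatio_sq (q p : PosDensity μ) :
    ∀ᵐ ω ∂μ, sqrtRatio q p ω ^ 2 * p.dens ω = q.dens ω := by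
  filter_upwards [q.pos, p.pos] with ω hq hp
  rw [sqrtRatio, Real.sq_sqrt (div_nonneg hq.le hp.le)]
  field_simp

/-- Multiplication by `√(q / p)`, as an isometry from `L²(q)` to `L²(p)`. -/
noncomputable def mulSqrt (q p : PosDensity μ) : Lp ℝ 2 q.meas →ₗᵢ[ℝ] Lp ℝ 2 p.meas :=
  LinearMap.isometryOfInner
    { toFun f := (memLp_sqrtRatio_mul q p (Lp.stronglyMeasurable f) (Lp.memLp f)).toLp _
      map_add' f g := by
        refine Lp.ext ?_
        rw [← MemLp.toLp_add]
        refine ((MemLp.coeFn_toLp _).trans ?_).trans (MemLp.coeFn_toLp _).symm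
        filter_upwards [ae_meas_of_ae_meas p (Lp.coeFn_add f g)] with ω h
        rw [h, Pi.add_apply, Pi.add_apply, mul_add]
      map_smul' c f := by
        refine Lp.ext ?_
        rw [RingHom.id_apply, ← MemLp.toLp_const_smul]
        refine ((MemLp.coeFn_toLp _).trans ?_).trans (MemLp.coeFn_toLp _).symm
        filter_upwards [ae_meas_of_ae_meas p (Lp.coeFn_smul c f)] with ω h
        simp [h]
        ring } (by
    intro f g
    rw [inner_L2, inner_L2, p.integral_meas, q.integral_meas]
    refine integral_congr_ae ?_
    have hf := (ae_meas_iff p).1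
      (memLp_sqrtRatio_mul q p (Lp.stronglyMeasurable f) (Lp.memLp f)).coeFn_toLp
    have hg := (ae_meas_iff p).1
      (memLp_sqrtRatio_mul q p (Lp.stronglyMeasurable g) (Lp.memLp g)).coeFn_toLp
    filter_upwards [hf, hg, mul_sqrtRatio_sq q p] with ω h1 h2 h3
    simp only [LinearMap.coe_mk, AddHom.coe_mk]
    rw [h1, h2, ← h3]
    ring)

theorem coeFn_mulSqrt (q p : PosDensity μ) (f : Lp ℝ 2 q.meas) :
    mulSqrt q p f =ᵐ[p.meas] fun ω => sqrtRatio q p ω * f ω :=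
  (memLp_sqrtRatio_mul q p (Lp.stronglyMeasurable f) (Lp.memLp f)).coeFn_toLp

theorem coeFn_mulSqrt_oneL2 (q p : PosDensity μ) :
    mulSqrt q p (oneL2 q) =ᵐ[p.meas] sqrtRatio q p := by
  filter_upwards [coeFn_mulSqrt q p (oneL2 q), ae_meas_of_ae_meas p (coeFn_oneL2 q)] with ω h1 h2
  rw [h1, h2, mul_one]

/-- The cocycle identity `√(q/r) √(p/q) = √(p/r)`: half-densities do not depend on the reference
density. -/
theorem mulSqrt_mulSqrt (p q r : PosDensity μ) (f : Lp ℝ 2 p.meas) :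
    mulSqrt q r (mulSqrt p q f) = mulSqrt p r f := by
  refine Lp.ext ?_
  filter_upwards [coeFn_mulSqrt q r (mulSqrt p q f), ae_meas_of_ae_meas r (coeFn_mulSqrt p q f),
    coeFn_mulSqrt p r f, (ae_meas_iff r).2 p.pos, (ae_meas_iff r).2 q.pos,
    (ae_meas_iff r).2 r.pos] with ω h1 h2 h3 hp hq hr
  rw [h1, h2, h3, ← mul_assoc, sqrtRatio, sqrtRatio, sqrtRatio,
    ← Real.sqrt_mul (div_nonneg hq.le hr.le)]
  congr 2
  field_simp

theorem mulSqrt_self (p : PosDensity μ) (f : Lp ℝ 2 p.meas) : mulSqrt p p f = f := by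
  refine Lp.ext ?_
  filter_upwards [coeFn_mulSqrt p p f, (ae_meas_iff p).2 p.pos] with ω h1 hp
  rw [h1, sqrtRatio, div_self hp.ne', Real.sqrt_one, one_mul]

theorem norm_mulSqrt_oneL2 (q p : PosDensity μ) : ‖mulSqrt q p (oneL2 q)‖ = 1 := by
  rw [LinearIsometry.norm_map, norm_oneL2]

theorem inner_mulSqrt_oneL2_coe (q p : PosDensity μ) (f : H q) :
    ⟪mulSqrt q p (oneL2 q), mulSqrt q p (f : Lp ℝ 2 q.meas)⟫_ℝ = 0 := by
  rw [LinearIsometry.inner_map_map, inner_oneL2_coe]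

theorem inner_oneL2_mulSqrt_oneL2 (q p : PosDensity μ) :
    ⟪oneL2 p, mulSqrt q p (oneL2 q)⟫_ℝ = ∫ ω, sqrtRatio q p ω ∂p.meas := by
  rw [inner_oneL2, integral_congr_ae (coeFn_mulSqrt_oneL2 q p)]

/-- Half-densities are nonnegative functions, so two of them are never antipodal. -/
theorem one_add_inner_ne_zero (q p : PosDensity μ) :
    1 + ⟪oneL2 p, mulSqrt q p (oneL2 q)⟫_ℝ ≠ 0 := by
  have : 0 ≤ ∫ x, sqrtRatio q p x ∂p.meas := integral_nonneg fun _ => Real.sqrt_nonneg _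
  rw [inner_oneL2_mulSqrt_oneL2]
  positivity

theorem coe_transport (q p : PosDensity μ) (f : H q) :
    (transport q p f : Lp ℝ 2 p.meas) =
      sphereTransport (oneL2 p) (mulSqrt q p (oneL2 q)) (mulSqrt q p (f : Lp ℝ 2 q.meas)) := by
  refine Lp.ext ?_
  refine (memLp_transportFun q p f).coeFn_toLp.trans ?_
  rw [sphereTransport, inner_oneL2_mulSqrt_oneL2, inner_oneL2,
    integral_congr_ae (coeFn_mulSqrt q p f)]
  set c := (1 + ∫ ω, sqrtRatio q p ω ∂p.meas)⁻¹
  set d := ∫ ω, sqrtRatio q p ω * (f : Lp ℝ 2 q.meas) ω ∂p.meas with hd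
  filter_upwards [Lp.coeFn_sub (mulSqrt q p (f : Lp ℝ 2 q.meas))
    ((c * d) • (oneL2 p + mulSqrt q p (oneL2 q))),
    Lp.coeFn_smul (c * d) (oneL2 p + mulSqrt q p (oneL2 q)),
    Lp.coeFn_add (oneL2 p) (mulSqrt q p (oneL2 q)), coeFn_mulSqrt q p (f : Lp ℝ 2 q.meas),
    coeFn_oneL2 p, coeFn_mulSqrt_oneL2 q p] with ω h1 h2 h3 h4 h5 h6
  rw [h1, Pi.sub_apply, h2, Pi.smul_apply, h3, Pi.add_apply, h4, h5, h6, transportFun, ← hd,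
    smul_eq_mul]
  ring

/-- The inverse transport recovers the half-density field from its coordinate, so regularity in the
bundle chart passes to `√(q/p) F(q)`. -/
theorem mulSqrt_coe_eq (q p : PosDensity μ) (f : H q) :
    mulSqrt q p (f : Lp ℝ 2 q.meas) =
      sphereTransport (mulSqrt q p (oneL2 q)) (oneL2 p) (transport q p f : Lp ℝ 2 p.meas) := by
  rw [coe_transport, sphereTransport_sphereTransport (norm_mulSqrt_oneL2 q p)
    (one_add_inner_ne_zero q p) (inner_mulSqrt_oneL2_coe q p f)]

theorem transport_self (p : PosDensity μ) (f : H p) : transport p p f = f := by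
  refine Subtype.ext ?_
  rw [coe_transport, mulSqrt_self, mulSqrt_self, sphereTransport_self (inner_oneL2_coe f)]

theorem transport_add (q p : PosDensity μ) (f g : H q) :
    transport q p (f + g) = transport q p f + transport q p g := by
  refine Subtype.ext ?_
  simp only [coe_transport, Submodule.coe_add, map_add, sphereTransport, inner_add_right, mul_add,
    add_smul]
  abel

theorem transport_smul (q p : PosDensity μ) (c : ℝ) (f : H q) :
    transport q p (c • f) = c • transport q p f := by
  refine Subtype.ext ?_
  simp only [coe_transport, Submodule.coe_smul, map_smul, sphereTransport, inner_smul_right,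
    smul_sub, smul_smul]
  congr 2
  ring

theorem inner_transport (q p : PosDensity μ) (f g : H q) :
    ⟪transport q p f, transport q p g⟫_ℝ = ⟪f, g⟫_ℝ := by
  change ⟪(transport q p f : Lp ℝ 2 p.meas), (transport q p g : Lp ℝ 2 p.meas)⟫_ℝ = _
  rw [coe_transport, coe_transport, inner_sphereTransport (norm_oneL2 p) (norm_mulSqrt_oneL2 q p)
    (one_add_inner_ne_zero q p) (inner_mulSqrt_oneL2_coe q p f) (inner_mulSqrt_oneL2_coe q p g),
    LinearIsometry.inner_map_map]
  rfl

/-- The orthogonal projection `f ↦ f - E_p[f]` from `L²(p)` to `H_p`. -/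
noncomputable def centerL2 (p : PosDensity μ) : Lp ℝ 2 p.meas →L[ℝ] H p :=
  (ContinuousLinearMap.id ℝ _ - (innerSL ℝ (oneL2 p)).smulRight (oneL2 p)).codRestrict
    (hilbertSubmodule p) fun f => by
      change ∫ ω, _ ∂p.meas = 0
      rw [← inner_oneL2]
      simp [inner_sub_right, inner_smul_right, norm_oneL2]

theorem coe_centerL2 (p : PosDensity μ) (f : Lp ℝ 2 p.meas) :
    (centerL2 p f : Lp ℝ 2 p.meas) = f - ⟪oneL2 p, f⟫_ℝ • oneL2 p := rfl

theorem centerL2_coe (p : PosDensity μ) (f : H p) : centerL2 p f = f := by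
  refine Subtype.ext ?_
  rw [coe_centerL2, inner_oneL2_coe, zero_smul, sub_zero]

/-! ### The exponential on the Orlicz space -/

/-- All terms of the series of `cosh` are nonnegative; those of index `0` and `k` are kept, and the
first cancels the `-1` in `Phi`. -/
theorem pow_le_Phi {k : ℕ} (hk : k ≠ 0) (x : ℝ) : x ^ (2 * k) ≤ (2 * k).factorial * Phi x := by
  have h := sum_le_hasSum {0, k} (fun n _ => by
    have := (even_two_mul n).pow_nonneg x
    positivity) (Real.hasSum_cosh x)
  rw [Finset.sum_pair hk.symm] at h
  simp only [mul_zero, pow_zero, Nat.factorial_zero, Nat.cast_one, div_one] at h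
  have h1 : x ^ (2 * k) / (2 * k).factorial ≤ Phi x := by
    rw [Phi]; linarith
  rwa [div_le_iff₀' (by positivity)] at h1

/-- The inequality of means with equal weights bounds `∏ x_i²` by the average of `x_i^{2k}`, to
which `pow_le_Phi` applies. -/
theorem prod_sq_le_sum_Phi {k : ℕ} (hk : k ≠ 0) (x : Fin k → ℝ) :
    (∏ i, x i) ^ 2 ≤ (k : ℝ)⁻¹ * (2 * k).factorial * ∑ i, Phi (x i) := by
  have hk' : (k : ℝ) ≠ 0 := Nat.cast_ne_zero.2 hk
  have h := Real.geom_mean_le_arith_mean_weighted Finset.univ (fun _ : Fin k => (k : ℝ)⁻¹)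
    (fun i => (x i ^ 2) ^ k) (fun _ _ => by positivity) (by simp [hk']) (fun _ _ => by positivity)
  simp only [Real.pow_rpow_inv_natCast (sq_nonneg _) hk] at h
  rw [Finset.prod_pow, ← Finset.mul_sum] at h
  refine h.trans ?_
  rw [mul_assoc]
  refine mul_le_mul_of_nonneg_left ?_ (by positivity)
  rw [Finset.mul_sum]
  refine Finset.sum_le_sum fun i _ => ?_
  rw [← pow_mul]
  exact pow_le_Phi hk _

theorem factorial_two_mul_le (k : ℕ) : (2 * k).factorial ≤ (2 ^ k * k.factorial) ^ 2 := by
  induction k with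
  | zero => simp
  | succ k ih =>
    rw [show 2 * (k + 1) = 2 * k + 1 + 1 by ring, Nat.factorial_succ, Nat.factorial_succ,
      Nat.factorial_succ, pow_succ 2 k]
    calc (2 * k + 1 + 1) * ((2 * k + 1) * (2 * k).factorial)
        ≤ (2 * k + 1 + 1) * ((2 * k + 1 + 1) * (2 ^ k * k.factorial) ^ 2) := by
          gcongr
          omega
      _ = _ := by ring

namespace Orlicz

variable {p : PosDensity μ}

theorem integrable_Phi_of_modular_lt_top {v : Ω → ℝ} (hv : AEStronglyMeasurable v p.meas)
    (h : modular p v < ∞) : Integrable (fun ω => Phi (v ω)) p.meas := by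
  refine ⟨continuous_Phi.comp_aestronglyMeasurable hv, ?_⟩
  rw [hasFiniteIntegral_iff_ofReal (.of_forall fun _ => Phi_nonneg _)]
  exact h

theorem integrable_Phi {v : Orlicz p} (hv : v ∈ unitBall p) :
    Integrable (fun ω => Phi (v ω)) p.meas :=
  integrable_Phi_of_modular_lt_top v.stronglyMeasurable.aestronglyMeasurable
    (lt_of_le_of_lt hv ENNReal.one_lt_top)

theorem integral_Phi_le_one {v : Orlicz p} (hv : v ∈ unitBall p) :
    ∫ ω, Phi (v ω) ∂p.meas ≤ 1 := by
  rw [integral_eq_lintegral_of_nonneg_ae (.of_forall fun _ => Phi_nonneg _)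
    (integrable_Phi hv).aestronglyMeasurable]
  exact ENNReal.toReal_le_of_le_ofReal zero_le_one (by rw [ENNReal.ofReal_one]; exact hv)

theorem mem_unitBall_of_norm_lt_one {v : Orlicz p} (hv : ‖v‖ < 1) : v ∈ unitBall p := by
  obtain ⟨b, hb0, hb1, w, hw, rfl⟩ := exists_lt_of_gauge_lt absorbent_unitBall hv
  exact smul_mem_unitBall hw (by rw [abs_of_pos hb0]; exact hb1.le)

theorem norm_le_one_of_mem_unitBall {v : Orlicz p} (hv : v ∈ unitBall p) : ‖v‖ ≤ 1 :=
  gauge_le_one_of_mem hv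

/-- The factor `2` leaves room for the strict inequality in `mem_unitBall_of_norm_lt_one`, so
closedness of the unit ball is not needed. -/
theorem exists_eq_smul_mem_unitBall (v : Orlicz p) :
    ∃ w ∈ unitBall p, v = (2 * ‖v‖) • w := by
  rcases eq_or_ne v 0 with rfl | hv
  · exact ⟨0, mem_unitBall_of_norm_lt_one (by simp), by simp⟩
  · have h : 0 < 2 * ‖v‖ := by positivity
    refine ⟨(2 * ‖v‖)⁻¹ • v, mem_unitBall_of_norm_lt_one ?_, (smul_inv_smul₀ h.ne' v).symm⟩
    rw [norm_smul, norm_inv, Real.norm_of_nonneg h.le, inv_mul_lt_iff₀ h]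
    linarith [norm_pos_iff.2 hv]

theorem stronglyMeasurable_prod {k : ℕ} (v : Fin k → Orlicz p) :
    StronglyMeasurable fun ω => ∏ i, v i ω :=
  Finset.stronglyMeasurable_fun_prod _ fun i _ => (v i).stronglyMeasurable

theorem integrable_prod_sq_of_mem_unitBall {k : ℕ} {v : Fin k → Orlicz p}
    (hv : ∀ i, v i ∈ unitBall p) :
    Integrable (fun ω => (∏ i, v i ω) ^ 2) p.meas ∧
      ∫ ω, (∏ i, v i ω) ^ 2 ∂p.meas ≤ (2 * k).factorial := by
  rcases eq_or_ne k 0 with rfl | hk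
  · simp
  have hi : Integrable (fun ω => (k : ℝ)⁻¹ * (2 * k).factorial * ∑ i, Phi (v i ω)) p.meas :=
    (integrable_finsetSum _ fun i _ => integrable_Phi (hv i)).const_mul _
  have h1 : Integrable (fun ω => (∏ i, v i ω) ^ 2) p.meas :=
    hi.mono' ((stronglyMeasurable_prod v).pow 2).aestronglyMeasurable (.of_forall fun ω => by
      rw [Real.norm_of_nonneg (sq_nonneg _)]
      exact prod_sq_le_sum_Phi hk _)
  refine ⟨h1, (integral_mono h1 hi fun ω => prod_sq_le_sum_Phi hk _).trans ?_⟩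
  rw [integral_const_mul, integral_finsetSum _ fun i _ => integrable_Phi (hv i)]
  have h2 : ∑ i, ∫ ω, Phi (v i ω) ∂p.meas ≤ k := by
    simpa using Finset.sum_le_card_nsmul Finset.univ _ 1 fun i _ => integral_Phi_le_one (hv i)
  calc (k : ℝ)⁻¹ * (2 * k).factorial * ∑ i, ∫ ω, Phi (v i ω) ∂p.meas
      ≤ (k : ℝ)⁻¹ * (2 * k).factorial * k := by gcongr
    _ = (2 * k).factorial := by
      have : (k : ℝ) ≠ 0 := Nat.cast_ne_zero.2 hk
      field_simp

theorem integrable_prod_sq {k : ℕ} (v : Fin k → Orlicz p) :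
    Integrable (fun ω => (∏ i, v i ω) ^ 2) p.meas ∧
      ∫ ω, (∏ i, v i ω) ^ 2 ∂p.meas ≤ (∏ i, (2 * ‖v i‖)) ^ 2 * (2 * k).factorial := by
  choose w hw hvw using fun i => exists_eq_smul_mem_unitBall (v i)
  obtain ⟨h1, h2⟩ := integrable_prod_sq_of_mem_unitBall hw
  have h3 : (fun ω => (∏ i, (2 * ‖v i‖)) ^ 2 * (∏ i, w i ω) ^ 2) =ᵐ[p.meas]
      fun ω => (∏ i, v i ω) ^ 2 := by
    have : ∀ᵐ ω ∂p.meas, ∀ i, v i ω = 2 * ‖v i‖ * w i ω := ae_all_iff.2 fun i => by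
      have := coeFn_smul (2 * ‖v i‖) (w i)
      rw [← hvw] at this
      exact this
    filter_upwards [this] with ω h
    rw [← mul_pow, ← Finset.prod_mul_distrib]
    simp only [h]
  refine ⟨(h1.const_mul _).congr h3, ?_⟩
  rw [← integral_congr_ae h3, integral_const_mul]
  gcongr

theorem memLp_prod {k : ℕ} (v : Fin k → Orlicz p) :
    MemLp (fun ω => ((2 ^ k * k.factorial : ℝ)⁻¹ * ∏ i, v i ω)) 2 p.meas :=
  ((memLp_two_iff_integrable_sq (stronglyMeasurable_prod v).aestronglyMeasurable).2
    (integrable_prod_sq v).1).const_mul _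

theorem norm_sq_L2 (f : Lp ℝ 2 p.meas) : ‖f‖ ^ 2 = ∫ ω, f ω ^ 2 ∂p.meas := by
  rw [← real_inner_self_eq_norm_sq, L2.inner_def]
  simp [sq]

/-- The moment bound costs `(2k)!`, which is absorbed by the square of the normalization `2^k k!`.
What remains is the factor `2` lost for each argument, which makes the radius of convergence at
least `1/2`. -/
theorem norm_toLp_prod_le {k : ℕ} (v : Fin k → Orlicz p) :
    ‖(memLp_prod v).toLp _‖ ≤ 2 ^ k * ∏ i, ‖v i‖ := by
  refine le_of_sq_le_sq ?_ (by positivity)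
  have hc : ∏ i, (2 * ‖v i‖) = 2 ^ k * ∏ i, ‖v i‖ := by
    rw [Finset.prod_mul_distrib]; simp
  have h := (integrable_prod_sq v).2
  have h2 : ((2 * k).factorial : ℝ) ≤ (2 ^ k * k.factorial) ^ 2 := by
    exact_mod_cast factorial_two_mul_le k
  rw [norm_sq_L2, integral_congr_ae (g := fun ω => (2 ^ k * k.factorial : ℝ)⁻¹ ^ 2 *
      (∏ i, v i ω) ^ 2) ((memLp_prod v).coeFn_toLp.mono fun ω h => by
        rw [h, mul_pow]), integral_const_mul, ← hc]
  calc (2 ^ k * k.factorial : ℝ)⁻¹ ^ 2 * ∫ ω, (∏ i, v i ω) ^ 2 ∂p.meas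
      ≤ (2 ^ k * k.factorial : ℝ)⁻¹ ^ 2 *
        ((∏ i, (2 * ‖v i‖)) ^ 2 * (2 ^ k * k.factorial) ^ 2) := by
        gcongr
        exact h.trans (by gcongr)
    _ = _ := by
        field_simp

/-- The multilinear map `(v₁, …, v_k) ↦ v₁ ⋯ v_k / (2^k k!)` from `L^Φ(p)` to `L²(p)`. -/
noncomputable def expSeries (p : PosDensity μ) :
    FormalMultilinearSeries ℝ (Orlicz p) (Lp ℝ 2 p.meas) := fun k =>
  MultilinearMap.mkContinuous
    { toFun v := (memLp_prod v).toLp _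
      map_update_add' v i x y := by
        refine Lp.ext ?_
        rw [← MemLp.toLp_add]
        refine ((MemLp.coeFn_toLp _).trans ?_).trans (MemLp.coeFn_toLp _).symm
        filter_upwards [coeFn_add x y] with ω h
        have hu (z : Orlicz p) (j : Fin k) : (Function.update v i z j) ω =
            Function.update (fun j => v j ω) i (z ω) j :=
          Function.apply_update (fun _ (z : Orlicz p) => z ω) v i z j
        simp only [hu, h, Pi.add_apply, ← mul_add]
        congr 1
        exact (MultilinearMap.mkPiAlgebra ℝ (Fin k) ℝ).map_update_add _ i (x ω) (y ω)
      map_update_smul' v i c x := by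
        refine Lp.ext ?_
        rw [← MemLp.toLp_const_smul]
        refine ((MemLp.coeFn_toLp _).trans ?_).trans (MemLp.coeFn_toLp _).symm
        filter_upwards [coeFn_smul c x] with ω h
        have hu (z : Orlicz p) (j : Fin k) : (Function.update v i z j) ω =
            Function.update (fun j => v j ω) i (z ω) j :=
          Function.apply_update (fun _ (z : Orlicz p) => z ω) v i z j
        simp only [hu, h, Pi.smul_apply, smul_eq_mul, mul_left_comm c]
        congr 1
        exact (MultilinearMap.mkPiAlgebra ℝ (Fin k) ℝ).map_update_smul _ i c (x ω) }
    (2 ^ k) norm_toLp_prod_le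

theorem coeFn_expSeries (k : ℕ) (v : Fin k → Orlicz p) :
    expSeries p k v =ᵐ[p.meas] fun ω => (2 ^ k * k.factorial : ℝ)⁻¹ * ∏ i, v i ω :=
  (memLp_prod v).coeFn_toLp

theorem norm_expSeries_le (k : ℕ) : ‖expSeries p k‖ ≤ 2 ^ k :=
  MultilinearMap.mkContinuous_norm_le _ (by positivity) _

theorem le_radius_expSeries : ENNReal.ofReal (1 / 2) ≤ (expSeries p).radius := by
  refine (expSeries p).le_radius_of_bound 1 fun k => ?_
  rw [Real.coe_toNNReal _ (by norm_num), one_div]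
  calc ‖expSeries p k‖ * 2⁻¹ ^ k ≤ 2 ^ k * 2⁻¹ ^ k := by gcongr; exact norm_expSeries_le k
    _ = 1 := by rw [← mul_pow]; norm_num

/-- The map `v ↦ e^{v/2}` from a neighbourhood of `0` in `L^Φ(p)` to `L²(p)`. -/
noncomputable def expHalf (v : Orlicz p) : Lp ℝ 2 p.meas := (expSeries p).sum v

theorem hasFPowerSeriesOnBall_expHalf :
    HasFPowerSeriesOnBall (expHalf (p := p)) (expSeries p) 0 (ENNReal.ofReal (1 / 2)) :=
  ((expSeries p).hasFPowerSeriesOnBall (lt_of_lt_of_le (by simp) le_radius_expSeries)).mono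
    (by simp) le_radius_expSeries

/-- Convergence of the series in `L²` gives almost sure convergence of a subsequence of the partial
sums, and pointwise these are the partial sums of the scalar exponential series. -/
theorem coeFn_expHalf {v : Orlicz p} (hv : ‖v‖ < 1 / 2) :
    expHalf v =ᵐ[p.meas] fun ω => Real.exp (v ω / 2) := by
  have hs := hasFPowerSeriesOnBall_expHalf.hasSum (y := v) (by
    rw [Metric.mem_eball, edist_zero_right, ← ofReal_norm]
    exact (ENNReal.ofReal_lt_ofReal_iff (by norm_num)).2 hv)
  rw [zero_add] at hs
  obtain ⟨ns, hns, hlim⟩ :=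
    (tendstoInMeasure_of_tendsto_Lp hs.tendsto_sum_nat).exists_seq_tendsto_ae
  have h1 : ∀ᵐ ω ∂p.meas, ∀ n, (∑ k ∈ Finset.range n, expSeries p k fun _ => v : Lp ℝ 2 p.meas) ω =
      ∑ k ∈ Finset.range n, (v ω / 2) ^ k / k.factorial := by
    refine ae_all_iff.2 fun n => ?_
    induction n with
    | zero =>
      simp only [Finset.range_zero, Finset.sum_empty]
      exact Lp.coeFn_zero _ _ _
    | succ n ih =>
      simp only [Finset.sum_range_succ]
      filter_upwards [ih, Lp.coeFn_add (∑ k ∈ Finset.range n, expSeries p k fun _ => v)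
        (expSeries p n fun _ => v), coeFn_expSeries n (fun _ => v)] with ω h1 h2 h3
      rw [h2, Pi.add_apply, h1, h3]
      simp [div_pow]
      field_simp
  filter_upwards [hlim, h1] with ω h2 h3
  refine tendsto_nhds_unique h2 ?_
  simp only [h3]
  have := (NormedSpace.expSeries_div_hasSum_exp (v ω / 2)).tendsto_sum_nat
  rw [← Real.exp_eq_exp_ℝ] at this
  exact this.comp hns.tendsto_atTop

theorem contDiffAt_expHalf {v : Orlicz p} (hv : ‖v‖ < 1 / 2) (n : WithTop ℕ∞) :
    ContDiffAt ℝ n (expHalf (p := p)) v :=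
  (hasFPowerSeriesOnBall_expHalf.analyticAt_of_mem (by
    rw [Metric.mem_eball, edist_zero_right, ← ofReal_norm]
    exact (ENNReal.ofReal_lt_ofReal_iff (by norm_num)).2 hv)).contDiffAt

theorem coeFn_fderiv_expHalf_zero (v : Orlicz p) :
    fderiv ℝ (expHalf (p := p)) 0 v =ᵐ[p.meas] fun ω => v ω / 2 := by
  rw [(hasFPowerSeriesOnBall_expHalf (p := p)).hasFPowerSeriesAt.hasFDerivAt.fderiv]
  refine (coeFn_expSeries 1 _).trans (.of_forall fun ω => ?_)
  simp
  ring

end Orlicz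

/-! ### Patches and charts -/

theorem PosDensity.ext_of_ae {q r : PosDensity μ} (h : q.dens =ᵐ[μ] r.dens) : q = r := by
  cases q
  cases r
  congr 1
  exact Lp.ext h

/-- Both densities integrate to `1`, which forces `c = 1`. Thus densities can be identified without
computing normalizing constants. -/
theorem PosDensity.ext_of_ae_const_mul {q r : PosDensity μ} (c : ℝ)
    (h : ∀ᵐ ω ∂μ, q.dens ω = c * r.dens ω) : q = r := by
  have hc : c = 1 := by
    have := q.integral_eq_one
    rwa [integral_congr_ae h, integral_const_mul, r.integral_eq_one, mul_one] at this
  exact PosDensity.ext_of_ae (h.mono fun ω hω => by rw [hω, hc, one_mul])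

theorem B.ext_ae {p : PosDensity μ} {u v : B p} (h : ⇑u =ᵐ[p.meas] ⇑v) : u = v :=
  Subtype.ext (Orlicz.toAE_injective (AEEqFun.ext h))

theorem Orlicz.ext_ae {p : PosDensity μ} {u v : Orlicz p} (h : ⇑u =ᵐ[p.meas] ⇑v) : u = v :=
  Orlicz.toAE_injective (AEEqFun.ext h)

theorem Orlicz.coeFn_sub {p : PosDensity μ} (v w : Orlicz p) :
    ⇑(v - w) =ᵐ[p.meas] ⇑v - ⇑w := by
  rw [map_sub]; exact AEEqFun.coeFn_sub _ _

theorem coeFn_centered {p : PosDensity μ} {f : Ω → ℝ} {v : Orlicz p} (h : ⇑v =ᵐ[p.meas] f) :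
    ⇑(centered p f) =ᵐ[p.meas] fun ω => f ω - ∫ x, f x ∂p.meas := by
  have h' : ∃ v : Orlicz p, ⇑v =ᵐ[p.meas] f := ⟨v, h⟩
  rw [centered, dif_pos h']
  filter_upwards [Orlicz.coeFn_sub h'.choose (Orlicz.const p (∫ ω, h'.choose ω ∂p.meas)),
    h'.choose_spec, Orlicz.coeFn_const p (∫ ω, h'.choose ω ∂p.meas)] with ω h1 h2 h3
  rw [h1, Pi.sub_apply, h2, h3, integral_congr_ae h'.choose_spec]

/-- The bound `e^x ≤ 2 (Φ(x) + 1)` makes the open unit ball part of the domain of the patch. -/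
theorem integrable_exp_of_norm_lt_one {p : PosDensity μ} {u : Orlicz p} (hu : ‖u‖ < 1) :
    Integrable (fun ω => Real.exp (u ω)) p.meas := by
  refine (((Orlicz.integrable_Phi (Orlicz.mem_unitBall_of_norm_lt_one hu)).add
    (integrable_const 1)).const_mul 2).mono'
    (Real.continuous_exp.comp_stronglyMeasurable u.stronglyMeasurable).aestronglyMeasurable
    (.of_forall fun ω => ?_)
  rw [Real.norm_of_nonneg (Real.exp_pos _).le]
  simp only [Pi.add_apply, Phi, Real.cosh_eq]
  linarith [Real.exp_pos (-u ω)]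

theorem ball_subset_chartTarget (p : PosDensity μ) : Metric.ball (0 : B p) 1 ⊆ chartTarget p :=
  interior_maximal (fun u hu => integrable_exp_of_norm_lt_one (by simpa using hu))
    Metric.isOpen_ball

theorem integrable_exp_of_mem_chartTarget {p : PosDensity μ} {u : B p} (hu : u ∈ chartTarget p) :
    Integrable (fun ω => Real.exp (u ω)) p.meas := by
  have h : u ∈ {u : B p | Integrable (fun ω => Real.exp (u ω)) p.meas} := interior_subset hu
  exact h

theorem chartTarget_mem_nhds (p : PosDensity μ) : chartTarget p ∈ 𝓝 (0 : B p) :=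
  mem_of_superset (Metric.ball_mem_nhds _ one_pos) (ball_subset_chartTarget p)

theorem dens_patch {p : PosDensity μ} {u : B p}
    (h : Integrable (fun ω => Real.exp (u ω)) p.meas) :
    (patch p u).dens =ᵐ[μ] fun ω => Real.exp (u ω - cumulant p u) * p.dens ω := by
  rw [patch, dif_pos h]
  exact (integrable_patch p u h).coeFn_toL1

theorem dens_patch_of_norm_lt_one {p : PosDensity μ} {u : B p} (hu : ‖u‖ < 1) :
    (patch p u).dens =ᵐ[μ] fun ω => Real.exp (u ω - cumulant p u) * p.dens ω :=
  dens_patch (integrable_exp_of_norm_lt_one (u := (u : Orlicz p)) hu)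

theorem coeFn_zero_B (p : PosDensity μ) : ⇑(0 : B p) =ᵐ[p.meas] fun _ => 0 := by
  change ⇑(Orlicz.toAE (0 : Orlicz p)) =ᵐ[p.meas] _
  rw [map_zero]
  exact AEEqFun.coeFn_zero

theorem patch_zero (p : PosDensity μ) : patch p 0 = p := by
  refine PosDensity.ext_of_ae_const_mul (Real.exp (-cumulant p 0)) ?_
  filter_upwards [dens_patch (integrable_exp_of_norm_lt_one (u := ((0 : B p) : Orlicz p))
    (by simp)), (ae_meas_iff p).1 (coeFn_zero_B p)] with ω h1 h2
  rw [h1, h2, zero_sub]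

/-- Here `log (q/p) = u - K_p(u)`, and centering removes the constant because `u` is centered. -/
theorem chart_patch {p : PosDensity μ} {u : B p}
    (h : Integrable (fun ω => Real.exp (u ω)) p.meas) : chart p (patch p u) = u := by
  have h1 : (fun ω => Real.log ((patch p u).dens ω / p.dens ω)) =ᵐ[p.meas]
      fun ω => u ω - cumulant p u := by
    refine (ae_meas_iff p).2 ?_
    filter_upwards [dens_patch h, p.pos] with ω h1 h2
    rw [h1, mul_div_cancel_right₀ _ h2.ne', Real.log_exp]
  have h2 : ⇑((u : Orlicz p) - Orlicz.const p (cumulant p u)) =ᵐ[p.meas]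
      fun ω => Real.log ((patch p u).dens ω / p.dens ω) := by
    filter_upwards [h1, Orlicz.coeFn_sub (u : Orlicz p) (Orlicz.const p (cumulant p u)),
      Orlicz.coeFn_const p (cumulant p u)] with ω h3 h4 h5
    rw [h3, h4, Pi.sub_apply, h5]
  have h3 : ∫ ω, u ω ∂p.meas = 0 := u.2
  refine B.ext_ae ?_
  filter_upwards [coeFn_centered h2, h1] with ω h4 h5
  rw [chart, h4, h5, integral_congr_ae h1, integral_sub (Orlicz.integrable _) (integrable_const _),
    h3]
  simp

theorem IsCurveAt.eventually_eq {γ : ℝ → PosDensity μ} {p : PosDensity μ} {w : B p}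
    (h : IsCurveAt γ p w) : ∀ᶠ t in 𝓝 0, γ t = patch p (chart p (γ t)) := by
  filter_upwards [h.mem] with t ht
  obtain ⟨u, hu, hut⟩ := ht
  rw [← hut, chart_patch (integrable_exp_of_mem_chartTarget hu)]

theorem chart_self (p : PosDensity μ) : chart p p = 0 := by
  have := chart_patch (integrable_exp_of_mem_chartTarget
    (mem_of_mem_nhds (chartTarget_mem_nhds p)))
  rwa [patch_zero] at this

theorem exists_isCurveAt (p : PosDensity μ) (w : B p) :
    ∃ γ : ℝ → PosDensity μ, IsCurveAt γ p w := by
  have h1 : HasDerivAt (fun t : ℝ => t • w) w 0 := by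
    simpa using (hasDerivAt_id (0 : ℝ)).smul_const w
  have h2 : ∀ᶠ t : ℝ in 𝓝 0, t • w ∈ chartTarget p :=
    h1.continuousAt.eventually_mem (by simpa using chartTarget_mem_nhds p)
  -- The curve is the one-dimensional exponential family in the direction `w`, a straight line in
  -- the chart at `p`.
  refine ⟨fun t => patch p (t • w), by simp [patch_zero], h2.mono fun t ht => ⟨_, ht, rfl⟩, ?_⟩
  exact h1.congr_of_eventuallyEq (h2.mono fun t ht =>
    chart_patch (integrable_exp_of_mem_chartTarget ht))

/-! ### The half-density of a patch -/

/-- The half-density `√(e_p(u) / p)` in `L²(p)`. -/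
noncomputable def halfDensity (p : PosDensity μ) (u : B p) : Lp ℝ 2 p.meas :=
  mulSqrt (patch p u) p (oneL2 (patch p u))

theorem halfDensity_zero (p : PosDensity μ) : halfDensity p 0 = oneL2 p := by
  rw [halfDensity, patch_zero, mulSqrt_self]

theorem norm_halfDensity (p : PosDensity μ) (u : B p) : ‖halfDensity p u‖ = 1 :=
  norm_mulSqrt_oneL2 _ _

theorem norm_expHalf_pos {p : PosDensity μ} {u : Orlicz p} (hu : ‖u‖ < 1 / 2) :
    0 < ‖Orlicz.expHalf u‖ := by
  have h : ‖Orlicz.expHalf u‖ ^ 2 = ∫ ω, Real.exp (u ω) ∂p.meas := by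
    rw [Orlicz.norm_sq_L2]
    refine integral_congr_ae ((Orlicz.coeFn_expHalf hu).mono fun ω h => ?_)
    simp only [h]
    rw [← Real.exp_nat_mul]
    congr 1
    push_cast
    ring
  have h2 : 0 < ∫ ω, Real.exp (u ω) ∂p.meas :=
    integral_exp_pos (integrable_exp_of_norm_lt_one (by linarith))
  rw [← h] at h2
  exact (norm_nonneg _).lt_of_ne fun h0 => by simp [← h0] at h2

/-- The two vectors differ by the positive factor `e^{-K_p(u)/2}`, and the half-density has norm
`1`. Smoothness thus follows from that of the norm away from `0`, without treating `K_p` separately.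
-/
theorem halfDensity_eq {p : PosDensity μ} {u : B p} (hu : ‖u‖ < 1 / 2) :
    halfDensity p u = ‖Orlicz.expHalf (u : Orlicz p)‖⁻¹ • Orlicz.expHalf (u : Orlicz p) := by
  have hint := integrable_exp_of_norm_lt_one (u := (u : Orlicz p)) (lt_trans hu (by norm_num))
  have h0 := norm_expHalf_pos (u := (u : Orlicz p)) hu
  have h1 : halfDensity p u =
      Real.exp (-cumulant p u / 2) • Orlicz.expHalf (u : Orlicz p) := by
    refine Lp.ext ?_
    filter_upwards [coeFn_mulSqrt_oneL2 (patch p u) p, (ae_meas_iff p).2 (dens_patch hint),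
      (ae_meas_iff p).2 p.pos, Orlicz.coeFn_expHalf (v := (u : Orlicz p)) hu,
      Lp.coeFn_smul (Real.exp (-cumulant p u / 2)) (Orlicz.expHalf (u : Orlicz p))]
      with ω h1 h2 h3 h4 h5
    rw [halfDensity, h1, h5, Pi.smul_apply, h4, sqrtRatio, h2, mul_div_cancel_right₀ _ h3.ne',
      ← Real.exp_half, smul_eq_mul, ← Real.exp_add]
    congr 1
    ring
  have h2 := norm_halfDensity p u
  rw [h1, norm_smul, Real.norm_of_nonneg (Real.exp_pos _).le] at h2
  rw [h1, eq_inv_of_mul_eq_one_left h2]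

theorem eventually_norm_lt {p : PosDensity μ} {u : B p} {c : ℝ} (hu : ‖u‖ < c) :
    ∀ᶠ v in 𝓝 u, ‖v‖ < c :=
  continuous_norm.continuousAt.eventually_lt continuousAt_const hu

theorem contDiffAt_expHalf_coe {p : PosDensity μ} {u : B p} (hu : ‖u‖ < 1 / 2) (n : WithTop ℕ∞) :
    ContDiffAt ℝ n (fun v : B p => Orlicz.expHalf (v : Orlicz p)) u :=
  (Orlicz.contDiffAt_expHalf hu n).comp u (tangentSubmodule p).subtypeL.contDiff.contDiffAt

theorem contDiffAt_halfDensity {p : PosDensity μ} {u : B p} (hu : ‖u‖ < 1 / 2)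
    (n : WithTop ℕ∞) : ContDiffAt ℝ n (halfDensity p) u := by
  have h1 := contDiffAt_expHalf_coe hu n
  have h0 := norm_expHalf_pos (u := (u : Orlicz p)) hu
  refine (((h1.norm ℝ (norm_pos_iff.1 h0)).inv h0.ne').smul h1).congr_of_eventuallyEq ?_
  exact (eventually_norm_lt hu).mono fun v hv => halfDensity_eq hv

theorem differentiableAt_halfDensity {p : PosDensity μ} {u : B p} (hu : ‖u‖ < 1 / 2) :
    DifferentiableAt ℝ (halfDensity p) u :=
  (contDiffAt_halfDensity hu 1).differentiableAt (by norm_num)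

theorem expHalf_zero (p : PosDensity μ) : Orlicz.expHalf (0 : Orlicz p) = oneL2 p := by
  refine Lp.ext ?_
  filter_upwards [Orlicz.coeFn_expHalf (v := (0 : Orlicz p)) (by simp), coeFn_oneL2 p,
    coeFn_zero_B p] with ω h1 h2 h3
  have h3' : (0 : Orlicz p) ω = 0 := h3
  rw [h1, h2, h3', zero_div, Real.exp_zero]

/-- The derivative is `w/2` plus a multiple of `1` coming from the normalization. It is orthogonal
to `1` because the half-density stays on the unit sphere, and so is the centered `w/2`; hence the
multiple is zero. -/
theorem coeFn_fderiv_halfDensity_zero {p : PosDensity μ} (w : B p) :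
    fderiv ℝ (halfDensity p) 0 w =ᵐ[p.meas] fun ω => w ω / 2 := by
  have hz : ‖(0 : B p)‖ < 1 / 2 := by simp
  have h0 := norm_expHalf_pos (u := ((0 : B p) : Orlicz p)) hz
  have h1 : HasFDerivAt (fun v : B p => Orlicz.expHalf (v : Orlicz p))
      ((fderiv ℝ (Orlicz.expHalf (p := p)) 0).comp (tangentSubmodule p).subtypeL) 0 :=
    (((Orlicz.contDiffAt_expHalf (v := (0 : Orlicz p)) (by simp) 1).differentiableAt
      (by norm_num)).hasFDerivAt).comp (0 : B p) (tangentSubmodule p).subtypeL.hasFDerivAt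
  have h2 : HasFDerivAt (fun v : B p => ‖Orlicz.expHalf (v : Orlicz p)‖⁻¹) _ 0 :=
    ((((contDiffAt_expHalf_coe hz 1).norm ℝ (norm_pos_iff.1 h0)).inv h0.ne').differentiableAt
      (by norm_num)).hasFDerivAt
  set c' := fderiv ℝ (fun v : B p => ‖Orlicz.expHalf (v : Orlicz p)‖)⁻¹ 0
  have h3 := ((h2.smul h1).congr_of_eventuallyEq ((eventually_norm_lt hz).mono fun v hv =>
    halfDensity_eq hv))
  have h4 : fderiv ℝ (halfDensity p) 0 w =
      fderiv ℝ (Orlicz.expHalf (p := p)) 0 (w : Orlicz p) + c' w • oneL2 p := by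
    rw [h3.fderiv]
    simp [expHalf_zero, norm_oneL2]
  have hw := Orlicz.coeFn_fderiv_expHalf_zero (w : Orlicz p)
  have h5 : ⟪oneL2 p, fderiv ℝ (Orlicz.expHalf (p := p)) 0 (w : Orlicz p)⟫_ℝ = 0 := by
    have h6 : ∫ ω, w ω ∂p.meas = 0 := w.2
    rw [inner_oneL2, integral_congr_ae hw, integral_div, h6, zero_div]
  have h6 : ⟪oneL2 p, fderiv ℝ (halfDensity p) 0 w⟫_ℝ = 0 := by
    have h7 := (differentiableAt_halfDensity hz).hasFDerivAt.norm_sq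
    simp only [norm_halfDensity, halfDensity_zero] at h7
    have h8 := DFunLike.congr_fun (h7.unique (hasFDerivAt_const _ _)) w
    simpa using h8
  have h7 : c' w = 0 := by
    rw [h4, inner_add_right, h5, inner_smul_right, real_inner_self_eq_norm_sq, norm_oneL2] at h6
    simpa using h6
  rw [h4, h7, zero_smul, add_zero]
  exact hw

/-! ### Change of charts -/

theorem Orlicz.abs_integral_le {p : PosDensity μ} (v : Orlicz p) :
    |∫ ω, v ω ∂p.meas| ≤ 10 * ‖v‖ := by
  obtain ⟨w, hw, hvw⟩ := Orlicz.exists_eq_smul_mem_unitBall v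
  have h1 : |∫ ω, w ω ∂p.meas| ≤ 5 := by
    calc |∫ ω, w ω ∂p.meas| ≤ ∫ ω, (1 + 4 * Phi (w ω)) ∂p.meas := by
          rw [← Real.norm_eq_abs]
          refine norm_integral_le_of_norm_le ((integrable_const (1 : ℝ)).add
            ((Orlicz.integrable_Phi hw).const_mul 4)) (.of_forall fun ω => ?_)
          have := sq_le_Phi (w ω)
          rw [Real.norm_eq_abs]
          nlinarith [sq_abs (w ω), sq_nonneg (|w ω| - 1)]
      _ ≤ 5 := by
          rw [integral_add (integrable_const 1) ((Orlicz.integrable_Phi hw).const_mul 4),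
            integral_const_mul]
          have := Orlicz.integral_Phi_le_one hw
          simp
          linarith
  have h2 : ∫ ω, v ω ∂p.meas = 2 * ‖v‖ * ∫ ω, w ω ∂p.meas := by
    have h3 := Orlicz.coeFn_smul (2 * ‖v‖) w
    rw [← hvw] at h3
    rw [integral_congr_ae h3, ← integral_const_mul]
    rfl
  rw [h2, abs_mul, abs_of_nonneg (by positivity)]
  nlinarith [norm_nonneg v]

/-- The expectation as a continuous linear functional on `L^Φ(p)`. -/
noncomputable def meanOrlicz (p : PosDensity μ) : Orlicz p →L[ℝ] ℝ :=
  LinearMap.mkContinuous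
    { toFun v := ∫ ω, v ω ∂p.meas
      map_add' v w := by
        rw [integral_congr_ae (Orlicz.coeFn_add v w)]
        exact integral_add v.integrable w.integrable
      map_smul' c v := by
        rw [integral_congr_ae (Orlicz.coeFn_smul c v)]
        exact integral_const_mul c _ } 10 Orlicz.abs_integral_le

theorem Orlicz.const_eq_smul (p : PosDensity μ) (c : ℝ) :
    Orlicz.const p c = c • Orlicz.const p 1 := by
  refine Orlicz.ext_ae ?_
  filter_upwards [Orlicz.coeFn_const p c, Orlicz.coeFn_smul c (Orlicz.const p 1),
    Orlicz.coeFn_const p 1] with ω h1 h2 h3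
  rw [h1, h2, Pi.smul_apply, h3, smul_eq_mul, mul_one]

/-- The projection `v ↦ v - E_p[v]` from `L^Φ(p)` to `B_p`. -/
noncomputable def centerOrlicz (p : PosDensity μ) : Orlicz p →L[ℝ] B p :=
  (ContinuousLinearMap.id ℝ _ - (meanOrlicz p).smulRight (Orlicz.const p 1)).codRestrict
    (tangentSubmodule p) fun v => by
      have := sub_const_mem p v
      rwa [Orlicz.const_eq_smul] at this

theorem coeFn_centerOrlicz {p : PosDensity μ} (v : Orlicz p) :
    ⇑(centerOrlicz p v) =ᵐ[p.meas] fun ω => v ω - ∫ x, v x ∂p.meas := by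
  have h : ((centerOrlicz p v : B p) : Orlicz p) = v - Orlicz.const p (∫ x, v x ∂p.meas) := by
    rw [Orlicz.const_eq_smul]; rfl
  rw [h]
  filter_upwards [Orlicz.coeFn_sub v (Orlicz.const p (∫ x, v x ∂p.meas)),
    Orlicz.coeFn_const p (∫ x, v x ∂p.meas)] with ω h1 h2
  rw [h1, Pi.sub_apply, h2]

/-- Here `Φ(x) + 2 = 2 cosh² (x/2)` and `Φ(x/2) ≤ cosh (x/2)`, so this is `ab ≤ (a² + b²)/2` with `a
= cosh (x/2)`. It is used with `y = p/q` and integrated against `q`, which compares the Orlicz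
spaces of `p` and `q`. -/
theorem Phi_half_le (x y : ℝ) (hy : 0 ≤ y) : Phi (x / 2) * y ≤ (Phi x + 2) / 4 + y ^ 2 / 2 := by
  have h1 : Phi x + 2 = 2 * Real.cosh (x / 2) ^ 2 := by
    have := Real.cosh_sq (x / 2)
    have h2 := Real.cosh_two_mul (x / 2)
    rw [mul_div_cancel₀ _ two_ne_zero] at h2
    rw [Phi, h2]
    linarith
  have h2 : Phi (x / 2) ≤ Real.cosh (x / 2) := by rw [Phi]; linarith
  nlinarith [sq_nonneg (Real.cosh (x / 2) - y), mul_le_mul_of_nonneg_right h2 hy]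

/-- If `p / q` is `p`-integrable, then the unit ball of `L^Φ(q)` is bounded in `L^Φ(p)`. -/
theorem integrable_Phi_half {p q : PosDensity μ}
    (hpq : Integrable (fun ω => p.dens ω / q.dens ω) p.meas) {v : Orlicz q}
    (hv : v ∈ Orlicz.unitBall q) :
    Integrable (fun ω => Phi (v ω / 2)) p.meas ∧
      ∫ ω, Phi (v ω / 2) ∂p.meas ≤ 1 + (∫ ω, p.dens ω / q.dens ω ∂p.meas) / 2 := by
  have h1 : Integrable (fun ω => (Phi (v ω) + 2) / 4 * q.dens ω) μ :=
    q.integrable_meas_iff.1 (((Orlicz.integrable_Phi hv).add (integrable_const 2)).div_const 4)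
  have h2 : Integrable (fun ω => p.dens ω / q.dens ω * p.dens ω) μ := p.integrable_meas_iff.1 hpq
  have h3 : ∀ᵐ ω ∂μ, Phi (v ω / 2) * p.dens ω ≤
      (Phi (v ω) + 2) / 4 * q.dens ω + p.dens ω / q.dens ω * p.dens ω / 2 := by
    filter_upwards [p.pos, q.pos] with ω hp hq
    have := mul_le_mul_of_nonneg_right
      (Phi_half_le (v ω) (p.dens ω / q.dens ω) (div_nonneg hp.le hq.le)) hq.le
    calc Phi (v ω / 2) * p.dens ω = Phi (v ω / 2) * (p.dens ω / q.dens ω) * q.dens ω := by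
          field_simp
      _ ≤ _ := this
      _ = _ := by field_simp
  have h4 : Integrable (fun ω => Phi (v ω / 2) * p.dens ω) μ := by
    refine (h1.add (h2.div_const 2)).mono' ?_ ?_
    · exact ((continuous_Phi.comp_stronglyMeasurable
        (StronglyMeasurable.div v.stronglyMeasurable (stronglyMeasurable_const (b := 2)))).mul
        (Lp.stronglyMeasurable p.dens)).aestronglyMeasurable
    · filter_upwards [h3, p.pos] with ω h hp
      rw [Real.norm_of_nonneg (mul_nonneg (Phi_nonneg _) hp.le)]
      exact h
  refine ⟨p.integrable_meas_iff.2 h4, ?_⟩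
  rw [p.integral_meas]
  refine (integral_mono_ae h4 (h1.add (h2.div_const 2)) h3).trans ?_
  rw [integral_add' h1 (h2.div_const 2), integral_div, ← p.integral_meas,
    ← q.integral_meas fun ω => (Phi (v ω) + 2) / 4, integral_div,
    integral_add (Orlicz.integrable_Phi hv) (integrable_const 2)]
  have := Orlicz.integral_Phi_le_one hv
  simp
  linarith

/-- The class of `v` with respect to `p` and a bound for its Luxemburg norm, for `v` in the unit
ball of `L^Φ(q)`. -/
theorem exists_orlicz_of_mem_unitBall {p q : PosDensity μ}
    (hpq : Integrable (fun ω => p.dens ω / q.dens ω) p.meas) {v : Orlicz q}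
    (hv : v ∈ Orlicz.unitBall q) :
    ∃ w : Orlicz p, ⇑w =ᵐ[p.meas] v ∧ ‖w‖ ≤ 2 + ∫ ω, p.dens ω / q.dens ω ∂p.meas := by
  set C := 1 + (∫ ω, p.dens ω / q.dens ω ∂p.meas) / 2 with hC
  have hC1 : 1 ≤ C := by
    have : 0 ≤ ∫ ω, p.dens ω / q.dens ω ∂p.meas := by
      refine integral_nonneg_of_ae ((ae_meas_iff p).2 ?_)
      filter_upwards [p.pos, q.pos] with ω hp hq using div_nonneg hp.le hq.le
    rw [hC]
    linarith
  have hC0 : 0 < C := by linarith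
  obtain ⟨h1, h2⟩ := integrable_Phi_half hpq hv
  have h3 : modular p (fun ω => (2 * C)⁻¹ * v ω) ≤ 1 := by
    calc modular p (fun ω => (2 * C)⁻¹ * v ω)
        ≤ ∫⁻ ω, ENNReal.ofReal (C⁻¹ * Phi (v ω / 2)) ∂p.meas := by
          refine lintegral_mono fun ω => ENNReal.ofReal_le_ofReal ?_
          -- Convexity and `Φ(0) = 0` give `Φ(C⁻¹ x) ≤ C⁻¹ Φ(x)`, as `C ≥ 1`.
          have := Phi_convex (inv_nonneg.2 hC0.le) (sub_nonneg.2 (inv_le_one_of_one_le₀ hC1))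
            (by ring) (v ω / 2) 0
          rw [Phi_zero, mul_zero, add_zero, add_zero] at this
          beta_reduce
          rwa [mul_inv, mul_comm 2⁻¹, mul_assoc, inv_mul_eq_div 2]
      _ = ENNReal.ofReal (C⁻¹ * ∫ ω, Phi (v ω / 2) ∂p.meas) := by
          rw [← ofReal_integral_eq_lintegral_ofReal (h1.const_mul _)
            (.of_forall fun ω => mul_nonneg (inv_nonneg.2 hC0.le) (Phi_nonneg _)),
            integral_const_mul]
      _ ≤ 1 := by
          rw [ENNReal.ofReal_le_one, inv_mul_le_iff₀ hC0, mul_one]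
          exact h2
  have h4 :
      (AEEqFun.mk v v.stronglyMeasurable.aestronglyMeasurable : Ω →ₘ[p.meas] ℝ) =ᵐ[p.meas] v :=
    AEEqFun.coeFn_mk _ _
  let w : Orlicz p := ⟨AEEqFun.mk v v.stronglyMeasurable.aestronglyMeasurable, (2 * C)⁻¹,
    by positivity, by
      rw [modular_congr p (w := fun ω => (2 * C)⁻¹ * v ω) (h4.mono fun ω h => by simp only [h])]
      exact h3.trans_lt ENNReal.one_lt_top⟩
  have hw : ⇑w =ᵐ[p.meas] v := h4
  refine ⟨w, hw, ?_⟩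
  have h5 : (2 * C)⁻¹ • w ∈ Orlicz.unitBall p := by
    change modular p _ ≤ 1
    rwa [modular_congr p (w := fun ω => (2 * C)⁻¹ * v ω)]
    filter_upwards [Orlicz.coeFn_smul (2 * C)⁻¹ w, hw] with ω h6 h7
    rw [h6, Pi.smul_apply, h7, smul_eq_mul]
  have h6 := Orlicz.norm_le_one_of_mem_unitBall h5
  rw [norm_smul, norm_inv, Real.norm_of_nonneg (by positivity), inv_mul_le_iff₀ (by positivity)]
    at h6
  linarith

theorem exists_orlicz {p q : PosDensity μ}
    (hpq : Integrable (fun ω => p.dens ω / q.dens ω) p.meas) (v : Orlicz q) :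
    ∃ w : Orlicz p, ⇑w =ᵐ[p.meas] v ∧
      ‖w‖ ≤ 2 * (2 + ∫ ω, p.dens ω / q.dens ω ∂p.meas) * ‖v‖ := by
  obtain ⟨v', hv', h⟩ := v.exists_eq_smul_mem_unitBall
  obtain ⟨w, hw, hwn⟩ := exists_orlicz_of_mem_unitBall hpq hv'
  refine ⟨(2 * ‖v‖) • w, ?_, ?_⟩
  · have h1 := Orlicz.coeFn_smul (2 * ‖v‖) v'
    rw [← h] at h1
    filter_upwards [Orlicz.coeFn_smul (2 * ‖v‖) w, hw, ae_meas_of_ae_meas p h1] with ω h2 h3 h4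
    rw [h2, h4, Pi.smul_apply, Pi.smul_apply, h3]
  · rw [norm_smul, Real.norm_of_nonneg (by positivity)]
    nlinarith [mul_le_mul_of_nonneg_left hwn (norm_nonneg v)]

/-- The inclusion of `L^Φ(q)` in `L^Φ(p)`, if `p / q` is `p`-integrable. -/
theorem exists_orliczInclusion {p q : PosDensity μ}
    (hpq : Integrable (fun ω => p.dens ω / q.dens ω) p.meas) :
    ∃ J : Orlicz q →L[ℝ] Orlicz p, ∀ v, ⇑(J v) =ᵐ[p.meas] v := by
  choose J hJ hJn using exists_orlicz hpq
  refine ⟨LinearMap.mkContinuous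
    { toFun := J
      map_add' v w := Orlicz.ext_ae ?_
      map_smul' c v := Orlicz.ext_ae ?_ } _ hJn, hJ⟩
  · filter_upwards [hJ (v + w), hJ v, hJ w, Orlicz.coeFn_add (J v) (J w),
      ae_meas_of_ae_meas p (Orlicz.coeFn_add v w)] with ω h1 h2 h3 h4 h5
    rw [h1, h4, h5, Pi.add_apply, Pi.add_apply, h2, h3]
  · filter_upwards [hJ (c • v), hJ v, Orlicz.coeFn_smul c (J v),
      ae_meas_of_ae_meas p (Orlicz.coeFn_smul c v)] with ω h1 h2 h3 h4
    rw [RingHom.id_apply, h1, h3, h4, Pi.smul_apply, Pi.smul_apply, h2]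

theorem integrable_div_patch {p : PosDensity μ} {u : B p} (hu : ‖u‖ < 1) :
    Integrable (fun ω => p.dens ω / (patch p u).dens ω) p.meas := by
  have h1 : Integrable (fun ω => Real.exp ((-u : B p) ω)) p.meas :=
    integrable_exp_of_norm_lt_one (u := ((-u : B p) : Orlicz p)) (by simpa using hu)
  refine (h1.const_mul (Real.exp (cumulant p u))).congr ?_
  have h2 : ⇑(-u : B p) =ᵐ[p.meas] -⇑u := by
    change ⇑(Orlicz.toAE (-(u : Orlicz p))) =ᵐ[p.meas] _
    rw [map_neg]
    exact AEEqFun.coeFn_neg _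
  filter_upwards [h2, (ae_meas_iff p).2 (dens_patch (integrable_exp_of_norm_lt_one hu)),
    (ae_meas_iff p).2 p.pos] with ω h3 h4 h5
  rw [h3, h4, Pi.neg_apply, ← Real.exp_add, div_mul_cancel_right₀ h5.ne', ← Real.exp_neg]
  congr 1
  ring

/-- The inclusion of the Orlicz spaces guarantees that `centered` does not take its default value on
elements of `B q`, so that it is linear and continuous there. -/
theorem exists_centering {p q : PosDensity μ}
    (hpq : Integrable (fun ω => p.dens ω / q.dens ω) p.meas) :
    ∃ A : B q →L[ℝ] B p, ∀ v : B q, centered p v = A v ∧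
      ⇑(A v) =ᵐ[p.meas] fun ω => v ω - ∫ x, v x ∂p.meas := by
  obtain ⟨J, hJ⟩ := exists_orliczInclusion hpq
  have hA (v : B q) : ⇑(centerOrlicz p (J v)) =ᵐ[p.meas] fun ω => v ω - ∫ x, v x ∂p.meas := by
    filter_upwards [coeFn_centerOrlicz (J v), hJ v] with ω h1 h2
    rw [← h2, ← integral_congr_ae (hJ v)]
    exact h1
  exact ⟨(centerOrlicz p).comp (J.comp (tangentSubmodule q).subtypeL),
    fun v => ⟨B.ext_ae ((coeFn_centered (hJ v)).trans (hA v).symm), hA v⟩⟩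

/-- Both densities are proportional to `e^{u + v} p`; recentering `v` from `q` to `p` changes only
the constant. -/
theorem patch_patch {p q : PosDensity μ} {u u' : B p} {v : B q} (hq : q = patch p u)
    (hu : ‖u‖ < 1) (hv : ‖v‖ < 1) (hu' : ‖u + u'‖ < 1) (c : ℝ)
    (h : ⇑u' =ᵐ[p.meas] fun ω => v ω - c) : patch q v = patch p (u + u') := by
  refine PosDensity.ext_of_ae_const_mul
    (Real.exp (c + cumulant p (u + u') - cumulant p u - cumulant q v)) ?_
  have h4 : ⇑(u + u') =ᵐ[p.meas] fun ω => u ω + u' ω := Orlicz.coeFn_add u.1 u'.1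
  have hq' := dens_patch_of_norm_lt_one hu
  rw [← hq] at hq'
  filter_upwards [dens_patch_of_norm_lt_one hv, dens_patch_of_norm_lt_one hu', hq',
    (ae_meas_iff p).1 h4, (ae_meas_iff p).1 h] with ω h5 h6 h7 h8 h9
  rw [h5, h6, h7, h8, h9, ← mul_assoc, ← mul_assoc, ← Real.exp_add, ← Real.exp_add]
  congr 2
  ring

/-- The change of charts from `q = e_p(u)` to `p` is affine. -/
theorem exists_chart_change {p q : PosDensity μ} {u : B p} (hq : q = patch p u) (hu : ‖u‖ < 1) :
    ∃ A : B q →L[ℝ] B p, (∀ v : B q, centered p v = A v) ∧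
      ∀ᶠ v : B q in 𝓝 0, patch q v = patch p (u + A v) := by
  obtain ⟨A, hA⟩ := exists_centering (hq ▸ integrable_div_patch hu)
  refine ⟨A, fun v => (hA v).1, ?_⟩
  have h1 : ∀ᶠ v in 𝓝 (0 : B q), ‖u + A v‖ < 1 := by
    have : ContinuousAt (fun v => ‖u + A v‖) 0 :=
      (continuous_const.add A.continuous).norm.continuousAt
    exact this.eventually_lt continuousAt_const (by simpa using hu)
  filter_upwards [h1, eventually_norm_lt (u := (0 : B q)) (c := 1) (by simp)] with v h2 h3
  exact patch_patch hq hu h3 h2 _ (hA v).2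

/-! ### Sections of the Hilbert bundle as half-densities -/

/-- The section `F` of `H𝓜`, read in `L²(p)` as `u ↦ √(q/p) F(q)`, `q = e_p(u)`. -/
noncomputable def halfField (F : HField μ) (p : PosDensity μ) (u : B p) : Lp ℝ 2 p.meas :=
  mulSqrt (patch p u) p (F (patch p u) : Lp ℝ 2 (patch p u).meas)

theorem coe_coord (F : HField μ) (p : PosDensity μ) (u : B p) :
    (HField.coord F p u : Lp ℝ 2 p.meas) =
      sphereTransport (oneL2 p) (halfDensity p u) (halfField F p u) :=
  coe_transport _ _ _

theorem halfField_eq (F : HField μ) (p : PosDensity μ) (u : B p) :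
    halfField F p u =
      sphereTransport (halfDensity p u) (oneL2 p) (HField.coord F p u : Lp ℝ 2 p.meas) :=
  mulSqrt_coe_eq _ _ _

theorem halfField_zero (F : HField μ) (p : PosDensity μ) : halfField F p 0 = F p := by
  rw [halfField, patch_zero, mulSqrt_self]

theorem coord_zero (F : HField μ) (p : PosDensity μ) : HField.coord F p 0 = F p := by
  rw [HField.coord, patch_zero, transport_self]

theorem one_add_inner_halfDensity (p : PosDensity μ) (u : B p) :
    1 + ⟪oneL2 p, halfDensity p u⟫_ℝ ≠ 0 :=
  one_add_inner_ne_zero _ _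

theorem one_add_inner_halfDensity_left (p : PosDensity μ) (u : B p) :
    1 + ⟪halfDensity p u, oneL2 p⟫_ℝ ≠ 0 := by
  rw [real_inner_comm]
  exact one_add_inner_halfDensity p u

theorem contDiffAt_halfField {F : HField μ} {p : PosDensity μ} {u : B p} {n : WithTop ℕ∞}
    (hu : ‖u‖ < 1 / 2) (h : ContDiffAt ℝ n (HField.coord F p) u) :
    ContDiffAt ℝ n (halfField F p) u := by
  rw [funext (halfField_eq F p)]
  exact contDiffAt_sphereTransport (contDiffAt_halfDensity hu n) contDiffAt_const
    ((hilbertSubmodule p).subtypeL.contDiff.contDiffAt.comp u h)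
    (one_add_inner_halfDensity_left p u)

theorem contDiffAt_of_coe {V : Type*} [NormedAddCommGroup V] [NormedSpace ℝ V]
    {p : PosDensity μ} {f : V → H p} {v : V} {n : WithTop ℕ∞}
    (h : ContDiffAt ℝ n (fun w => (f w : Lp ℝ 2 p.meas)) v) : ContDiffAt ℝ n f v := by
  have := (centerL2 p).contDiff.contDiffAt.comp v h
  exact this.congr_of_eventuallyEq (.of_forall fun w => (centerL2_coe p (f w)).symm)

theorem hasFDerivAt_coord {F : HField μ} {p : PosDensity μ} {X' : B p →L[ℝ] Lp ℝ 2 p.meas}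
    (h : HasFDerivAt (halfField F p) X' 0) :
    HasFDerivAt (HField.coord F p) ((centerL2 p).comp X') 0 := by
  have h1 := hasFDerivAt_sphereTransport (norm_oneL2 p)
    (differentiableAt_halfDensity (u := (0 : B p)) (by simp)) h (halfDensity_zero p)
    (by rw [halfField_zero, inner_oneL2_coe])
  have h2 := (centerL2 p).hasFDerivAt.comp (0 : B p) h1
  refine (h2.congr_of_eventuallyEq (.of_forall fun u => ?_)).congr_fderiv ?_
  · simp only [Function.comp_apply]
    rw [← coe_coord, centerL2_coe]
  · ext1 v
    exact centerL2_coe p (centerL2 p (X' v))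

/-! ### The metric derivative of a differentiable section -/

theorem hasMetricDerivAt {F : HField μ} {p : PosDensity μ} (hF : HField.DiffAt F p) (w : B p) :
    HasMetricDerivAt F p w (fderiv ℝ (HField.coord F p) 0 w) := by
  intro γ hγ
  have h0 : chart p (γ 0) = 0 := by rw [hγ.start, chart_self]
  have h1 : HasFDerivAt (HField.coord F p) (fderiv ℝ (HField.coord F p) 0) (chart p (γ 0)) := by
    rw [h0]
    exact DifferentiableAt.hasFDerivAt hF
  refine (h1.comp_hasDerivAt 0 hγ.velocity).congr_of_eventuallyEq ?_
  filter_upwards [hγ.eventually_eq] with t ht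
  simp only [Function.comp_apply, HField.coord]
  rw [← ht]

/-- `HasMetricDerivAt` quantifies over all curves with the given velocity, so uniqueness depends on
the existence of one. -/
theorem HasMetricDerivAt.unique {F : HField μ} {p : PosDensity μ} {w : B p} {D D' : H p}
    (h : HasMetricDerivAt F p w D) (h' : HasMetricDerivAt F p w D') : D = D' := by
  obtain ⟨γ, hγ⟩ := exists_isCurveAt p w
  exact (h γ hγ).unique (h' γ hγ)

theorem metricDeriv_eq {F : HField μ} {p : PosDensity μ} (hF : HField.DiffAt F p)
    (G : TField μ) : metricDeriv G F p = fderiv ℝ (HField.coord F p) 0 (G p) := by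
  have h : ∃ D : H p, HasMetricDerivAt F p (G p) D := ⟨_, hasMetricDerivAt hF (G p)⟩
  rw [metricDeriv, dif_pos h]
  exact h.choose_spec.unique (hasMetricDerivAt hF (G p))

/-- Read in `L²(p)`, centering with respect to `q` is the projection orthogonal to `√(q/p)`. -/
theorem mulSqrt_centerL2 (p q : PosDensity μ) (f : Lp ℝ 2 p.meas) :
    mulSqrt q p (centerL2 q (mulSqrt p q f) : Lp ℝ 2 q.meas) =
      f - ⟪mulSqrt q p (oneL2 q), f⟫_ℝ • mulSqrt q p (oneL2 q) := by
  have h : ⟪oneL2 q, mulSqrt p q f⟫_ℝ = ⟪mulSqrt q p (oneL2 q), f⟫_ℝ := by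
    rw [← (mulSqrt q p).inner_map_map, mulSqrt_mulSqrt, mulSqrt_self]
  rw [coe_centerL2, map_sub, map_smul, mulSqrt_mulSqrt, mulSqrt_self, h]

/-- By the cocycle identity and the affine change of charts, the half-density field at `q` is
`mulSqrt p q` applied to the one at `p`, at the point `u + A v`. The chain rule then expresses the
derivative at `q` by data in the chart at `p`. -/
theorem metricDeriv_of_halfField {F : HField μ} (G : TField μ) {p q : PosDensity μ} {u : B p}
    (hq : q = patch p u) (hu : ‖u‖ < 1) (h : DifferentiableAt ℝ (halfField F p) u) :
    metricDeriv G F q =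
      centerL2 q (mulSqrt p q (fderiv ℝ (halfField F p) u (centered p (G q)))) := by
  obtain ⟨A, hA, hpatch⟩ := exists_chart_change hq hu
  have h0 : u + A 0 = u := by simp
  have h1 : HasFDerivAt (fun v => halfField F p (u + A v))
      ((fderiv ℝ (halfField F p) u).comp A) 0 := by
    have h2 : HasFDerivAt (halfField F p) (fderiv ℝ (halfField F p) u) (u + A 0) := by
      rw [h0]
      exact h.hasFDerivAt
    exact h2.comp (0 : B q) (A.hasFDerivAt.const_add u)
  have h2 : HasFDerivAt (halfField F q) ((mulSqrt p q).toContinuousLinearMap.comp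
      ((fderiv ℝ (halfField F p) u).comp A)) 0 := by
    refine ((mulSqrt p q).toContinuousLinearMap.hasFDerivAt.comp (0 : B q)
      h1).congr_of_eventuallyEq ?_
    filter_upwards [hpatch] with v hv
    simp only [Function.comp_apply, halfField, LinearIsometry.coe_toContinuousLinearMap]
    rw [mulSqrt_mulSqrt, hv]
  have h3 := hasFDerivAt_coord h2
  rw [metricDeriv_eq h3.differentiableAt, h3.fderiv, hA]
  rfl

theorem coe_coord_metricDeriv {F : HField μ} (G : TField μ) {p : PosDensity μ} {u : B p}
    (hu : ‖u‖ < 1) (h : DifferentiableAt ℝ (halfField F p) u) :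
    (HField.coord (metricDeriv G F) p u : Lp ℝ 2 p.meas) =
      sphereTransport (oneL2 p) (halfDensity p u)
        (fderiv ℝ (halfField F p) u (TField.coord G p u) -
          ⟪halfDensity p u, fderiv ℝ (halfField F p) u (TField.coord G p u)⟫_ℝ •
            halfDensity p u) := by
  rw [coe_coord, halfField, metricDeriv_of_halfField G rfl hu h, mulSqrt_centerL2]
  rfl

theorem contDiffAt_coord_metricDeriv_nat (n : ℕ) {G : TField μ} {F : HField μ}
    {p : PosDensity μ} (hG : TField.CDiffAt n G p) (hF : HField.CDiffAt (n + 1) F p) :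
    HField.CDiffAt n (metricDeriv G F) p := by
  have h0 : ‖(0 : B p)‖ < 1 / 2 := by simp
  have hX : ContDiffAt ℝ (n + 1) (halfField F p) 0 := contDiffAt_halfField h0 hF
  have hY : ContDiffAt ℝ n
      (fun u => fderiv ℝ (halfField F p) u (TField.coord G p u)) 0 :=
    (hX.fderiv_right le_rfl).clm_apply hG
  have hρ := contDiffAt_halfDensity h0 (n : WithTop ℕ∞)
  refine contDiffAt_of_coe ?_
  refine (contDiffAt_sphereTransport (contDiffAt_const (c := oneL2 p)) hρ
    (hY.sub ((hρ.inner ℝ hY).smul hρ)) (one_add_inner_halfDensity p 0)).congr_of_eventuallyEq ?_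
  -- The formula for the coordinate of `D_G F` needs the field to be differentiable at all points
  -- near `0`. Class `C^1` at `0` ensures this, also when `n = 0`.
  have h1 : ContDiffAt ℝ 1 (halfField F p) 0 := hX.of_le le_add_self
  filter_upwards [eventually_norm_lt (u := (0 : B p)) (c := 1) (by simp),
    h1.eventually (by simp)] with u hu hd
  exact coe_coord_metricDeriv G hu (hd.differentiableAt (by norm_num))

theorem contDiffAt_coord_metricDeriv (n : ℕ∞) {G : TField μ} {F : HField μ}
    {p : PosDensity μ} (hG : TField.CDiffAt n G p) (hF : HField.CDiffAt (n + 1) F p) :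
    HField.CDiffAt n (metricDeriv G F) p := by
  induction n using ENat.recTopCoe with
  | top =>
    refine contDiffAt_infty.2 fun k => ?_
    refine contDiffAt_coord_metricDeriv_nat k (ContDiffAt.of_le hG ?_) (ContDiffAt.of_le hF ?_)
    · exact_mod_cast le_top
    · gcongr
      exact_mod_cast le_top
  | coe k => exact contDiffAt_coord_metricDeriv_nat k hG hF

theorem isCovariantDerivative_metricDeriv : IsCovariantDerivative (μ := μ) metricDeriv where
  tensorial F p hF := ⟨fderiv ℝ (HField.coord F p) 0, fun G => metricDeriv_eq hF G⟩
  add G F₁ F₂ p h₁ h₂ := by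
    have h : HasFDerivAt (HField.coord (F₁ + F₂) p) _ 0 :=
      ((DifferentiableAt.hasFDerivAt h₁).add (DifferentiableAt.hasFDerivAt h₂))
        |>.congr_of_eventuallyEq (.of_forall fun u => transport_add _ _ _ _)
    rw [metricDeriv_eq h.differentiableAt, metricDeriv_eq h₁, metricDeriv_eq h₂, h.fderiv]
    rfl
  leibniz G F φ p hF hφ := by
    have h : HasFDerivAt (HField.coord (fun q => φ q • F q) p) _ 0 :=
      ((DifferentiableAt.hasFDerivAt hφ).smul (DifferentiableAt.hasFDerivAt hF))
        |>.congr_of_eventuallyEq (.of_forall fun u => transport_smul _ _ _ _)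
    rw [metricDeriv_eq h.differentiableAt, metricDeriv_eq hF, h.fderiv]
    simp [scalarDeriv, coord_zero, patch_zero, add_comm]
  contDiff n G F p hG hF := contDiffAt_coord_metricDeriv n hG hF

/-! ### The explicit formula -/

/-- By the subsequence principle, two successive extractions make both inputs converge almost
surely; pointwise limit rules then apply even to expressions such as quotients. -/
theorem tendstoInMeasure_of_forall_seq {ι : Type*} {l : Filter ι} [l.IsCountablyGenerated]
    {ν : Measure Ω} [IsFiniteMeasure ν] {f g h : ι → Ω → ℝ} {f' g' h' : Ω → ℝ}
    (hf : TendstoInMeasure ν f l f') (hg : TendstoInMeasure ν g l g')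
    (hh : ∀ i, AEStronglyMeasurable (h i) ν)
    (H : ∀ (ns : ℕ → ι) (ω : Ω), Tendsto ns atTop l →
      Tendsto (fun n => f (ns n) ω) atTop (𝓝 (f' ω)) →
      Tendsto (fun n => g (ns n) ω) atTop (𝓝 (g' ω)) →
      Tendsto (fun n => h (ns n) ω) atTop (𝓝 (h' ω))) :
    TendstoInMeasure ν h l h' := by
  intro ε hε
  refine tendsto_of_subseq_tendsto fun ns hns => ?_
  obtain ⟨m₁, hm₁, h₁⟩ := (hf.comp hns).exists_seq_tendsto_ae
  obtain ⟨m₂, hm₂, h₂⟩ := (hg.comp (hns.comp hm₁.tendsto_atTop)).exists_seq_tendsto_ae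
  refine ⟨m₁ ∘ m₂, ?_⟩
  refine tendstoInMeasure_of_tendsto_ae (f := fun n => h (ns (m₁ (m₂ n)))) (fun n => hh _) ?_ ε hε
  filter_upwards [h₁, h₂] with ω h₃ h₄
  exact H _ ω (hns.comp (hm₁.tendsto_atTop.comp hm₂.tendsto_atTop))
    (h₃.comp hm₂.tendsto_atTop) h₄

theorem tendstoInMeasure_slope {p : PosDensity μ} {f : ℝ → Lp ℝ 2 p.meas} {f' : Lp ℝ 2 p.meas}
    (h : HasDerivAt f f' 0) :
    TendstoInMeasure p.meas (fun t ω => (f t ω - f 0 ω) / t) (𝓝[≠] 0) f' := by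
  refine (tendstoInMeasure_of_tendsto_Lp (hasDerivAt_iff_tendsto_slope.1 h)).congr_left
    fun t => ?_
  rw [slope_def_module, sub_zero]
  filter_upwards [Lp.coeFn_smul t⁻¹ (f t - f 0), Lp.coeFn_sub (f t) (f 0)] with ω h1 h2
  rw [h1, Pi.smul_apply, h2, Pi.sub_apply, smul_eq_mul, div_eq_inv_mul]

theorem hasDerivAt_halfDensity_curve {γ : ℝ → PosDensity μ} {p : PosDensity μ} {w : B p}
    (hγ : IsCurveAt γ p w) :
    HasDerivAt (fun t => mulSqrt (γ t) p (oneL2 (γ t))) (fderiv ℝ (halfDensity p) 0 w) 0 := by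
  have h0 : chart p (γ 0) = 0 := by rw [hγ.start, chart_self]
  have h1 : HasFDerivAt (halfDensity p) (fderiv ℝ (halfDensity p) 0) (chart p (γ 0)) := by
    rw [h0]
    exact (differentiableAt_halfDensity (by simp)).hasFDerivAt
  refine (h1.comp_hasDerivAt 0 hγ.velocity).congr_of_eventuallyEq ?_
  filter_upwards [hγ.eventually_eq] with t ht
  simp only [Function.comp_apply, halfDensity]
  rw [← ht]

/-- With `X = ρ F` and `ρ = √(p(t)/p)`, the derivative `X'` exists in `L²(p)` and equals `Ḟ + ½ F(0)
w`, because `ρ(0) = 1` and `ρ' = w/2`. Hence the formula for `D` is the projection of `X'`, and `Ḟ`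
itself need only be a limit in probability. -/
theorem exists_explicitForm {γ : ℝ → PosDensity μ} {w : B (γ 0)} (F : ∀ t, H (γ t)) {D : H (γ 0)}
    (hγ : IsCurveAt γ (γ 0) w) (hD : HasDerivAt (fun t => transport (γ t) (γ 0) (F t)) D 0) :
    ∃ F' : Ω → ℝ, HasDotAtZero (γ 0) (fun t => F t) F' ∧ IsExplicitForm (γ 0) (F 0) F' w D := by
  let ρ : ℝ → Lp ℝ 2 (γ 0).meas := fun t => mulSqrt (γ t) (γ 0) (oneL2 (γ t))
  let X : ℝ → Lp ℝ 2 (γ 0).meas := fun t => mulSqrt (γ t) (γ 0) (F t : Lp ℝ 2 (γ t).meas)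
  have hρ : HasDerivAt ρ (fderiv ℝ (halfDensity (γ 0)) 0 w) 0 := hasDerivAt_halfDensity_curve hγ
  have hD' : HasDerivAt (fun t => (transport (γ t) (γ 0) (F t) : Lp ℝ 2 (γ 0).meas)) D 0 :=
    (hilbertSubmodule (γ 0)).subtypeL.hasFDerivAt.comp_hasDerivAt 0 hD
  have hX : DifferentiableAt ℝ X 0 := by
    have h1 : X = fun t => sphereTransport (ρ t) (oneL2 (γ 0))
        (transport (γ t) (γ 0) (F t) : Lp ℝ 2 (γ 0).meas) :=
      funext fun t => mulSqrt_coe_eq _ _ _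
    rw [h1]
    refine differentiableAt_sphereTransport hρ.differentiableAt (differentiableAt_const _)
      hD'.differentiableAt ?_
    rw [real_inner_comm]
    exact one_add_inner_ne_zero _ _
  have hX0 : X 0 = F 0 := mulSqrt_self _ _
  have hρ0 : ρ 0 = oneL2 (γ 0) := mulSqrt_self _ _
  obtain ⟨X', hX'⟩ : ∃ X', HasDerivAt X X' 0 := ⟨_, hX.hasDerivAt⟩
  have hDX : (D : Lp ℝ 2 (γ 0).meas) = X' - ⟪oneL2 (γ 0), X'⟫_ℝ • oneL2 (γ 0) := by
    have h1 := (hasFDerivAt_sphereTransport (norm_oneL2 (γ 0)) hρ.differentiableAt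
      hX'.hasFDerivAt hρ0 (by rw [hX0, inner_oneL2_coe])).hasDerivAt
    have h2 : HasDerivAt (fun t => (transport (γ t) (γ 0) (F t) : Lp ℝ 2 (γ 0).meas)) _ 0 :=
      h1.congr_of_eventuallyEq (.of_forall fun t => coe_transport _ _ _)
    rw [hD'.unique h2]
    simp
  have hw := coeFn_fderiv_halfDensity_zero w
  refine ⟨fun ω => X' ω - 1 / 2 * (F 0 : Lp ℝ 2 (γ 0).meas) ω * w ω, ⟨?_, ?_⟩, ?_, ?_⟩
  · exact (Lp.aestronglyMeasurable _).sub (((Lp.aestronglyMeasurable _).const_mul _).mul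
      (Orlicz.stronglyMeasurable _).aestronglyMeasurable)
  · have h1 := tendstoInMeasure_slope hX'
    have h2 := tendstoInMeasure_slope hρ
    -- For `t ≠ 0` this is `(F(t) - F(0))/t`, recovered from the slopes of `X` and `ρ` by the
    -- quotient rule. The denominator is `ρ(t)`, written through its slope so that its limit `1`
    -- also follows from the hypotheses on slopes.
    have h3 := tendstoInMeasure_of_forall_seq (h := fun t ω =>
        ((X t ω - X 0 ω) / t - X 0 ω * ((ρ t ω - ρ 0 ω) / t)) /
          (1 + t * ((ρ t ω - ρ 0 ω) / t)))
      (h' := fun ω => X' ω - X 0 ω * (fderiv ℝ (halfDensity (γ 0)) 0 w) ω) h1 h2 (fun t => by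
        have m1 := (Lp.aestronglyMeasurable (X t)).aemeasurable
        have m2 := (Lp.aestronglyMeasurable (X 0)).aemeasurable
        have m3 := (Lp.aestronglyMeasurable (ρ t)).aemeasurable
        have m4 := (Lp.aestronglyMeasurable (ρ 0)).aemeasurable
        exact ((((m1.sub m2).div_const t).sub (m2.mul ((m3.sub m4).div_const t))).div
          (((m3.sub m4).div_const t).const_mul t |>.const_add 1)).aestronglyMeasurable)
      (fun ns ω hns hf hg => by
        have hns0 : Tendsto ns atTop (𝓝 0) := hns.mono_right nhdsWithin_le_nhds
        have h4 := (hf.sub (hg.const_mul (X 0 ω))).div ((hns0.mul hg).const_add 1)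
          (by simp)
        rw [zero_mul, add_zero, div_one] at h4
        exact h4)
    refine h3.congr' ?_ ?_
    · filter_upwards [self_mem_nhdsWithin] with t ht
      have ht' : t ≠ 0 := ht
      have e1 : X t =ᵐ[(γ 0).meas] fun ω => sqrtRatio (γ t) (γ 0) ω * (F t : Lp ℝ 2 (γ t).meas) ω :=
        coeFn_mulSqrt _ _ _
      have e2 : ρ t =ᵐ[(γ 0).meas] sqrtRatio (γ t) (γ 0) := coeFn_mulSqrt_oneL2 _ _
      filter_upwards [e1, e2, coeFn_oneL2 (γ 0), (ae_meas_iff (γ 0)).2 (γ 0).pos,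
        (ae_meas_iff (γ 0)).2 (γ t).pos] with ω h4 h5 h6 h7 h8
      have h9 : 0 < sqrtRatio (γ t) (γ 0) ω := Real.sqrt_pos.2 (div_pos h8 h7)
      rw [h4, h5, hρ0, h6, hX0]
      have h10 : 1 + t * ((sqrtRatio (γ t) (γ 0) ω - 1) / t) = sqrtRatio (γ t) (γ 0) ω := by
        field_simp
        ring
      rw [h10]
      field_simp
      ring
    · filter_upwards [hw] with ω h4
      rw [h4, hX0]
      ring
  · refine (memLp_congr_ae (.of_forall fun ω => ?_)).2 (Lp.memLp X')
    ring
  · have h2 : ∀ x, X' x - 1 / 2 * (F 0 : Lp ℝ 2 (γ 0).meas) x * w x +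
        1 / 2 * (F 0 : Lp ℝ 2 (γ 0).meas) x * w x = X' x := fun x => by ring
    simp only [h2]
    rw [hDX, ← inner_oneL2]
    filter_upwards [Lp.coeFn_sub X' (⟪oneL2 (γ 0), X'⟫_ℝ • oneL2 (γ 0)),
      Lp.coeFn_smul ⟪oneL2 (γ 0), X'⟫_ℝ (oneL2 (γ 0)), coeFn_oneL2 (γ 0)] with ω h2 h3 h4
    rw [h2, Pi.sub_apply, h3, Pi.smul_apply, h4, smul_eq_mul, mul_one]

/-! ### Compatibility with the metric -/

/-- The isometry of the transport turns a pairing in the moving fiber into one in the fixed space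
`H_p`, where the product rule applies. -/
theorem integral_mul_eq_inner (F₁ F₂ : HField μ) (p : PosDensity μ) (u : B p) :
    ∫ ω, F₁ (patch p u) ω * F₂ (patch p u) ω ∂(patch p u).meas =
      ⟪HField.coord F₁ p u, HField.coord F₂ p u⟫_ℝ := by
  rw [HField.coord, HField.coord, inner_transport, ← inner_L2]
  rfl

theorem metricDeriv_metric (G : TField μ) {F₁ F₂ : HField μ} {p : PosDensity μ}
    (h₁ : HField.DiffAt F₁ p) (h₂ : HField.DiffAt F₂ p) :
    ScalarDiffAt (fun q => ∫ ω, F₁ q ω * F₂ q ω ∂q.meas) p ∧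
      scalarDeriv G (fun q => ∫ ω, F₁ q ω * F₂ q ω ∂q.meas) p =
        ∫ ω, metricDeriv G F₁ p ω * F₂ p ω ∂p.meas +
          ∫ ω, F₁ p ω * metricDeriv G F₂ p ω ∂p.meas := by
  rw [ScalarDiffAt, scalarDeriv]
  simp only [integral_mul_eq_inner]
  refine ⟨DifferentiableAt.inner ℝ h₁ h₂, ?_⟩
  rw [fderiv_inner_apply ℝ h₁ h₂, coord_zero, coord_zero, ← metricDeriv_eq h₁,
    ← metricDeriv_eq h₂, ← inner_L2, ← inner_L2, add_comm]
  rfl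

end ExpManifold

theorem mainTheorem2 {Ω : Type*} [MeasurableSpace Ω] (μ : Measure Ω) [SigmaFinite μ] :
    -- `D_G F` is a covariant derivative on the Hilbert bundle
    IsCovariantDerivative (μ := μ) metricDeriv ∧
    -- every tangent vector is the velocity of a curve
    (∀ (p : PosDensity μ) (w : B p), ∃ γ : ℝ → PosDensity μ, IsCurveAt γ p w) ∧
    -- `D_G F(p)` is the derivative of the transported field along every curve with velocity `G(p)`,
    -- and it is given by the explicit formula
    (∀ (G : TField μ) (F : HField μ) (p : PosDensity μ), HField.DiffAt F p →
      ∀ γ : ℝ → PosDensity μ, IsCurveAt γ p (G p) →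
        HasDerivAt (fun t => transport (γ t) p (F (γ t))) (metricDeriv G F p) 0 ∧
        ∃ F' : Ω → ℝ, HasDotAtZero p (fun t => F (γ t)) F' ∧
          IsExplicitForm p (F p) F' (G p) (metricDeriv G F p)) ∧
    -- the explicit formula for an arbitrary curve `(p(t), F(t))` in the Hilbert bundle
    (∀ (γ : ℝ → PosDensity μ) (w : B (γ 0)) (F : ∀ t, H (γ t)) (D : H (γ 0)),
      IsCurveAt γ (γ 0) w → HasDerivAt (fun t => transport (γ t) (γ 0) (F t)) D 0 →
        ∃ F' : Ω → ℝ, HasDotAtZero (γ 0) (fun t => F t) F' ∧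
          IsExplicitForm (γ 0) (F 0) F' w D) ∧
    -- `D_G` is metric
    (∀ (G : TField μ) (F₁ F₂ : HField μ) (p : PosDensity μ),
      HField.DiffAt F₁ p → HField.DiffAt F₂ p →
        ScalarDiffAt (fun q => ∫ ω, F₁ q ω * F₂ q ω ∂q.meas) p ∧
        scalarDeriv G (fun q => ∫ ω, F₁ q ω * F₂ q ω ∂q.meas) p =
          ∫ ω, metricDeriv G F₁ p ω * F₂ p ω ∂p.meas +
            ∫ ω, F₁ p ω * metricDeriv G F₂ p ω ∂p.meas) := by
  refine ⟨isCovariantDerivative_metricDeriv, exists_isCurveAt, fun G F p hF γ hγ => ?_,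
    fun γ w F D hγ hD => exists_explicitForm F hγ hD,
    fun G F₁ F₂ p h₁ h₂ => metricDeriv_metric G h₁ h₂⟩
  have h : HasDerivAt (fun t => transport (γ t) p (F (γ t))) (metricDeriv G F p) 0 := by
    rw [metricDeriv_eq hF]
    exact hasMetricDerivAt hF (G p) γ hγ
  refine ⟨h, ?_⟩
  -- Replacing `p` by `γ 0` makes `F p` and the value at `0` of `t ↦ F (γ t)` elements of the same
  -- fiber.
  obtain rfl := hγ.start
  exact exists_explicitForm (fun t => F (γ t)) hγ h
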